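/- Let $N\ge 1$ be an integer and let $\mathbb P^N$ be the space of real polynomials of degree at most $N$. For $\beta\in\{0,1\}$ let $P_N^{(0,\beta)}$ be the Jacobi polynomial, let $\xi^{(0,\beta)}_{0,N}<\dots<\xi^{(0,\beta)}_{N,N}$ be the $N+1$ roots of $(1-x^2)\,\partial_xP_N^{(0,\beta)}(x)$ in increasing order (so $\xi^{(0,\beta)}_{0,N}=-1$ and $\xi^{(0,\beta)}_{N,N}=1$), and let $\rho^{(0,\beta)}_{i,N}$ be the weights for which $$\int_{-1}^1 u(x)(1+x)^\beta\,dx=\sum_{i=0}^N u(\xi^{(0,\beta)}_{i,N})\,\rho^{(0,\beta)}_{i,N}\qquad\text{for all }u\in\mathbb P^{2N-1}.$$ Put $$\widetilde\rho_0=\rho^{(0,1)}_{0,N},\qquad \widetilde\rho_i=(1+\xi^{(0,0)}_{i,N})\,\rho^{(0,0)}_{i,N}\quad(1\le i\le N),$$ and define $$\|u\|_{\widetilde N}^2=\sum_{i=0}^N u(\xi^{(0,0)}_{i,N})^2\,\widetilde\rho_i,\qquad \|u\|_{(0,1)}^2=\int_{-1}^1u(x)^2(1+x)\,dx .$$ Let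 $D=\operatorname{diag}(\widetilde\rho_0,\dots,\widetilde\rho_N)$, and let $M$ be the mass matrix $M_{ij}=\int_{-1}^1L_i(x)L_j(x)(1+x)\,dx$, $0\le i,j\le N$, where $L_0,\dots,L_N$ are the Lagrange polynomials of the nodes $\xi^{(0,0)}_{0,N},\dots,\xi^{(0,0)}_{N,N}$. Then there is a constant $C>0$, independent of $N$, such that for every $N\ge1$: 1. for all $u\in\mathbb P^N$, $\ \|u\|_{\widetilde N}^2\le C\,\|u\|_{(0,1)}^2$ and $\|u\|_{(0,1)}^2\le C\,N\,\|u\|_{\widetilde N}^2$; 2. for all $\boldsymbol u\in\mathbb R^{N+1}$, $\ \boldsymbol u^TD\boldsymbol u\le C\,\boldsymbol u^TM\boldsymbol u$ and $\boldsymbol u^TM\boldsymbol u\le C\,N\,\boldsymbol u^TD\boldsymbol u$; 3. $D$ and $M$ are symmetric positive definite, and the condition number $\kappa(D^{-1}M)$, the ratio of the largest to the smallest modulus of the eigenvalues of $D^{-1}M$, satisfies $\kappa(D^{-1}M)\le C\,N$. -/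

import Mathlib

open Polynomial Matrix

namespace JacobiMass

/-- The weighted inner product `(u, v)_{(α, β)}` on `[-1, 1]`. -/
noncomputable def weightedInner (α β : ℕ) (u v : ℝ[X]) : ℝ :=
  ∫ x in (-1 : ℝ)..1, u.eval x * v.eval x * ((1 - x) ^ α * (1 + x) ^ β)

/-- The Jacobi polynomial `P_n^{(α, β)}` (for natural exponents), in the usual normalization
`P_n^{(α, β)}(1) = (n + α).choose n`, through its expansion in powers of `x - 1`. -/
noncomputable def jacobiP (α β n : ℕ) : ℝ[X] :=
  C (((n + α).factorial : ℝ) / (n.factorial * (n + α + β).factorial)) *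
    ∑ k ∈ Finset.range (n + 1),
      C ((n.choose k : ℝ) * ((n + k + α + β).factorial / (2 ^ k * (k + α).factorial))) *
        (X - 1) ^ k

/-- The polynomial `(1 - x²) ∂ₓP_N^{(α, β)}`, of degree `N + 1` when `1 ≤ N`. -/
noncomputable def lobattoPoly (α β N : ℕ) : ℝ[X] :=
  (1 - X ^ 2) * derivative (jacobiP α β N)

/-- The Jacobi--Gauss--Lobatto abscissas `ξ_{0,N} < ξ_{1,N} < ⋯ < ξ_{N,N}`: the roots of
`lobattoPoly α β N` in increasing order. For `1 ≤ N` there are exactly `N + 1` of them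
(so the default value `0` is not used), the first is `-1` and the last is `1`. -/
noncomputable def lobattoNode (α β N : ℕ) (i : Fin (N + 1)) : ℝ :=
  ((lobattoPoly α β N).roots.toFinset.sort (· ≤ ·)).getD i 0

/-- `ρ` makes the quadrature rule at the `(α, β)`-Jacobi--Gauss--Lobatto abscissas exact for all
polynomials of degree at most `2N - 1`. -/
def IsLobattoWeights (α β N : ℕ) (ρ : Fin (N + 1) → ℝ) : Prop :=
  ∀ u : ℝ[X], u.natDegree ≤ 2 * N - 1 →
    ∫ x in (-1 : ℝ)..1, u.eval x * ((1 - x) ^ α * (1 + x) ^ β) =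
      ∑ i, u.eval (lobattoNode α β N i) * ρ i

/-- The Jacobi--Gauss--Lobatto weights `ρ_{i,N}^{(α, β)}`: the (unique, for `1 ≤ N`) weights of
the exact rule. -/
noncomputable def lobattoWeight (α β N : ℕ) : Fin (N + 1) → ℝ :=
  Classical.epsilon (IsLobattoWeights α β N)

/-- The Lagrange polynomials of the `(0, 0)` Gauss--Lobatto points. -/
noncomputable def lagrangeL (N : ℕ) (i : Fin (N + 1)) : ℝ[X] :=
  Lagrange.basis Finset.univ (lobattoNode 0 0 N) i

/-- The `(0, 1)`-weighted mass matrix `M_{ij} = ∫ L_i(x) L_j(x) (1 + x) dx`. -/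
noncomputable def massMatrix (N : ℕ) : Matrix (Fin (N + 1)) (Fin (N + 1)) ℝ :=
  Matrix.of fun i j => ∫ x in (-1 : ℝ)..1, (lagrangeL N i).eval x * (lagrangeL N j).eval x * (1 + x)

/-- The modified weights `ρ̃_i`. -/
noncomputable def lumpedWeight (N : ℕ) (i : Fin (N + 1)) : ℝ :=
  if i = 0 then lobattoWeight 0 1 N 0
  else (1 + lobattoNode 0 0 N i) * lobattoWeight 0 0 N i

/-- The diagonal preconditioner `D`. -/
noncomputable def lumpedMass (N : ℕ) : Matrix (Fin (N + 1)) (Fin (N + 1)) ℝ :=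
  Matrix.diagonal (lumpedWeight N)

/-- The discrete inner product `⟨u, v⟩_Ñ`. -/
noncomputable def discreteInner (N : ℕ) (u v : ℝ[X]) : ℝ :=
  ∑ i, u.eval (lobattoNode 0 0 N i) * v.eval (lobattoNode 0 0 N i) * lumpedWeight N i

/-- The moduli of the complex eigenvalues of a real square matrix. -/
def eigenvalueModuli {n : ℕ} (A : Matrix (Fin n) (Fin n) ℝ) : Set ℝ :=
  (fun z : ℂ => ‖z‖) '' spectrum ℂ (A.map (fun r : ℝ => (r : ℂ)))

/-- The (spectral) condition number `κ(A) = max |λ| / min |λ|` over the eigenvalues `λ` of `A`,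
for invertible `A`. -/
noncomputable def condNumber {n : ℕ} (A : Matrix (Fin n) (Fin n) ℝ) : ℝ :=
  sSup (eigenvalueModuli A) / sInf (eigenvalueModuli A)

end JacobiMass

/-! Put N = n + 1, let L_k be the Legendre polynomials, Q the Legendre-Gauss-Lobatto rule, A = ∫ L_N
u and B = ∫ L_{N-1} u. The factor 1 + x kills the node -1, so the discrete norm is Q((1 + x)u²) +
ρ̃_0 u(-1)². The integrand has degree at most 2N + 1, two above exactness, and the error is
explicit: a positive multiple, of order N, of A², plus (N + 1)AB (`quadrature_one_add_X_mul_sq`).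

Discrete by continuous: since (1 + x)P_k^{(0,1)} = L_k + L_{k+1}, Cauchy-Schwarz gives A² and (A +
B)² at most O(1/N) times the weighted norm squared, which absorbs the error. A reproducing kernel at
-1 gives u(-1)² = O(N⁴) times that norm squared, balanced by ρ̃_0 of order N⁻⁴.

Continuous by discrete: the A² and u(-1)² terms have a favourable sign, so only (N + 1)AB matters.
At the nodes x L_N = L_{N-1}; hence B = Q(L_N x u), while A is N/(2N + 1) times Q(L_N u).
Cauchy-Schwarz in the discrete norm bounds both quadratures uniformly
(`quadrature_legendre_mul_sq_le`), by closed forms for ρ_i L_N(ξ_i)², ∑ 1/(1 + ξ_i) and ρ̃_0. The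
multiplier N + 1 is the loss of N.

Nodal interpolation turns these into inequalities of quadratic forms, and the Rayleigh quotient
confines the eigenvalues of D⁻¹M to [1/10, 10N]. -/

namespace JacobiMass

/-! ### Integration on [-1, 1] and the Jacobi weights -/

/-- Integration over `[-1, 1]` as a linear functional on polynomials. -/
noncomputable def integral : ℝ[X] →ₗ[ℝ] ℝ where
  toFun u := ∫ x in (-1 : ℝ)..1, u.eval x
  map_add' u v := by
    simp only [eval_add]
    exact intervalIntegral.integral_add (u.continuous.intervalIntegrable _ _)
      (v.continuous.intervalIntegrable _ _)
  map_smul' c u := by simp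

theorem integral_apply (u : ℝ[X]) : integral u = ∫ x in (-1 : ℝ)..1, u.eval x := rfl

theorem integral_C_mul (c : ℝ) (u : ℝ[X]) : integral (C c * u) = c * integral u := by
  rw [← smul_eq_C_mul, map_smul, smul_eq_mul]

theorem integral_derivative (u : ℝ[X]) :
    integral (derivative u) = u.eval 1 - u.eval (-1) :=
  intervalIntegral.integral_eq_sub_of_hasDerivAt (fun x _ => u.hasDerivAt x)
    ((derivative u).continuous.intervalIntegrable _ _)

theorem integral_comp_neg (u : ℝ[X]) : integral (u.comp (-X)) = integral u := by
  simp only [integral_apply, eval_comp, eval_neg, eval_X]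
  have h := intervalIntegral.integral_comp_neg (a := -1) (b := 1) (fun x => u.eval x)
  simpa using h

theorem integral_pos {u : ℝ[X]} (h0 : u ≠ 0) (h : ∀ x ∈ Set.Ioo (-1 : ℝ) 1, 0 ≤ u.eval x) :
    0 < integral u := by
  have hc : ∀ x ∈ Set.Icc (-1 : ℝ) 1, 0 ≤ u.eval x := by
    have := closure_minimal (s := Set.Ioo (-1 : ℝ) 1) (t := {x | 0 ≤ u.eval x}) h
      (isClosed_le continuous_const u.continuous)
    rwa [closure_Ioo (by norm_num)] at this
  refine intervalIntegral.integral_pos (by norm_num) u.continuous.continuousOn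
    (fun x hx => hc x (Set.Ioc_subset_Icc_self hx)) ?_
  obtain ⟨x, hx, hr⟩ := (Set.Ioo_infinite (show (-1 : ℝ) < 1 by norm_num)).exists_notMem_finset
    u.roots.toFinset
  refine ⟨x, Set.Ioo_subset_Icc_self hx, lt_of_le_of_ne (h x hx) fun h1 => hr ?_⟩
  simp [h0, h1.symm]

/-- The Jacobi weight `(1 - x) ^ α * (1 + x) ^ β` as a polynomial. -/
noncomputable def weight (α β : ℕ) : ℝ[X] := (1 - X) ^ α * (1 + X) ^ β

theorem weight_ne_zero (α β : ℕ) : weight α β ≠ 0 := by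
  intro h
  have := congrArg (eval 0) h
  simp [weight] at this

theorem weight_eval_nonneg (α β : ℕ) {x : ℝ} (hx : x ∈ Set.Ioo (-1 : ℝ) 1) :
    0 ≤ (weight α β).eval x := by
  have h1 : 0 ≤ 1 - x := by linarith [hx.2]
  have h2 : 0 ≤ 1 + x := by linarith [hx.1]
  simp only [weight, eval_mul, eval_pow, eval_sub, eval_add, eval_one, eval_X]
  positivity

/-- The raised weight vanishes at both endpoints, so integration by parts against it has no boundary
terms. -/
theorem integral_weight_succ_derivative (α β : ℕ) (u : ℝ[X]) :
    integral (derivative (weight (α + 1) (β + 1) * u)) = 0 := by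
  rw [integral_derivative]; simp [weight]

/-- A linear functional vanishing on the powers `(X - 1) ^ k`, `k < n`, vanishes on the
polynomials of degree `< n`. -/
theorem map_eq_zero_of_shifted_powers {φ : ℝ[X] →ₗ[ℝ] ℝ} {n : ℕ}
    (h : ∀ k < n, φ ((X - 1) ^ k) = 0) {q : ℝ[X]} (hq : q.degree < n) : φ q = 0 := by
  rw [← sum_taylor_eq q 1, Polynomial.sum_def, map_sum]
  refine Finset.sum_eq_zero fun k hk => ?_
  have hk' : k < n := by
    have h1 := le_degree_of_mem_supp k hk
    rw [degree_taylor] at h1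
    exact_mod_cast lt_of_le_of_lt h1 hq
  rw [← smul_eq_C_mul, map_smul, C_1, h k hk', smul_zero]

/-! ### The Jacobi differential equation and orthogonality -/

/-- The Jacobi differential operator
`(1 - x²) p'' + (β - α - (α + β + 2) x) p'`. -/
noncomputable def jacobiOp (α β : ℕ) (p : ℝ[X]) : ℝ[X] :=
  (1 - X ^ 2) * derivative (derivative p) +
    (C ((β : ℝ) - α) - C ((α : ℝ) + β + 2) * X) * derivative p

/-- Sturm-Liouville form of the operator, the source of its symmetry. -/
theorem derivative_weight (α β : ℕ) (p : ℝ[X]) :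
    derivative (weight (α + 1) (β + 1) * derivative p) = weight α β * jacobiOp α β p := by
  simp only [weight, jacobiOp, derivative_mul, derivative_pow, derivative_sub, derivative_add,
    derivative_one, derivative_X, C_add, C_sub, Nat.add_sub_cancel, Nat.cast_add, Nat.cast_one,
    map_natCast, C_1, map_ofNat]
  ring

/-- The operator is bidiagonal in the powers of X - 1, so the eigenvalue equation becomes the
two-term recurrence `jacobiCoeff_succ`. -/
theorem jacobiOp_pow_succ (α β k : ℕ) :
    jacobiOp α β ((X - 1) ^ (k + 1)) =
      C (-((k + 1) * (k + α + β + 2) : ℝ)) * (X - 1) ^ (k + 1) -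
        C (2 * (k + 1) * (k + 1 + α) : ℝ) * (X - 1) ^ k := by
  rcases k with _ | k
  · simp only [jacobiOp, zero_add, pow_one, pow_zero, derivative_sub, derivative_one, derivative_X,
      sub_zero, Nat.cast_zero, C_add, C_sub, C_mul, C_neg, map_natCast, C_1, map_ofNat]
    ring
  · have hX : (1 - X ^ 2 : ℝ[X]) = -((X - 1) * ((X - 1) + 2)) := by ring
    simp only [jacobiOp, hX, derivative_mul, derivative_pow, derivative_sub, derivative_add,
      derivative_one, derivative_X, C_add, C_sub, C_mul, C_neg, Nat.add_sub_cancel, Nat.cast_add,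
      Nat.cast_one, map_natCast, C_1, map_ofNat, derivative_natCast, derivative_zero]
    ring

theorem jacobiOp_pow_zero (α β : ℕ) : jacobiOp α β ((X - 1) ^ 0) = 0 := by
  simp [jacobiOp]

/-- The differential operator as a linear map. -/
noncomputable def jacobiOpL (α β : ℕ) : ℝ[X] →ₗ[ℝ] ℝ[X] where
  toFun := jacobiOp α β
  map_add' u v := by simp only [jacobiOp, derivative_add]; ring
  map_smul' c u := by simp only [jacobiOp, smul_eq_C_mul, derivative_C_mul, RingHom.id_apply]; ring

/-- Coefficients of the Jacobi polynomial in powers of `X - 1`, up to normalization. -/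
noncomputable def jacobiCoeff (α β n k : ℕ) : ℝ :=
  (n.choose k : ℝ) * ((n + k + α + β).factorial / (2 ^ k * (k + α).factorial))

theorem jacobiCoeff_succ (α β n k : ℕ) :
    2 * (k + 1) * (k + 1 + α) * jacobiCoeff α β n (k + 1) =
      (n - k) * (n + k + α + β + 1) * jacobiCoeff α β n k := by
  rcases le_or_gt k n with hk | hk
  · have h1 : ((n.choose (k + 1) : ℕ) : ℝ) * (k + 1) = n.choose k * (n - k) := by
      have := Nat.choose_succ_right_eq n k
      rw [← Nat.cast_sub hk]; exact_mod_cast this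
    have h2 : ((n + (k + 1) + α + β).factorial : ℝ) =
        (n + k + α + β + 1) * (n + k + α + β).factorial := by
      rw [show n + (k + 1) + α + β = (n + k + α + β) + 1 by ring, Nat.factorial_succ]
      push_cast; ring
    have h3 : ((k + 1 + α).factorial : ℝ) = (k + 1 + α) * (k + α).factorial := by
      rw [show k + 1 + α = (k + α) + 1 by ring, Nat.factorial_succ]
      push_cast; ring
    have h4 : ((k + α).factorial : ℝ) ≠ 0 := by positivity
    have h5 : ((k : ℝ) + 1 + α) ≠ 0 := by positivity
    simp only [jacobiCoeff, h2, h3, pow_succ]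
    field_simp
    linear_combination h1
  · simp [jacobiCoeff, Nat.choose_eq_zero_of_lt hk, Nat.choose_eq_zero_of_lt (hk.trans (Nat.lt_succ_self k))]

theorem jacobiOp_jacobiP (α β n : ℕ) :
    jacobiOp α β (jacobiP α β n) = C (-(n * (n + α + β + 1) : ℝ)) * jacobiP α β n := by
  have key : jacobiOpL α β (∑ k ∈ Finset.range (n + 1), C (jacobiCoeff α β n k) * (X - 1) ^ k) =
      C (-(n * (n + α + β + 1) : ℝ)) *
        ∑ k ∈ Finset.range (n + 1), C (jacobiCoeff α β n k) * (X - 1) ^ k := by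
    rw [map_sum, Finset.sum_range_succ', Finset.mul_sum, Finset.sum_range_succ]
    have e0 : jacobiOpL α β (C (jacobiCoeff α β n 0) * (X - 1) ^ 0) = 0 := by
      rw [← smul_eq_C_mul, map_smul]
      exact smul_eq_zero_of_right _ (jacobiOp_pow_zero α β)
    have e1 : ∀ k, jacobiOpL α β (C (jacobiCoeff α β n (k + 1)) * (X - 1) ^ (k + 1)) =
        C (-((k + 1) * (k + α + β + 2) : ℝ) * jacobiCoeff α β n (k + 1)) * (X - 1) ^ (k + 1) -
        C ((n - k) * (n + k + α + β + 1) * jacobiCoeff α β n k) * (X - 1) ^ k := by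
      intro k
      rw [← smul_eq_C_mul, map_smul, smul_eq_C_mul, ← jacobiCoeff_succ]
      change C _ * jacobiOp α β _ = _
      rw [jacobiOp_pow_succ]
      simp only [C_mul]
      ring
    rw [e0, add_zero, Finset.sum_congr rfl fun k _ => e1 k, Finset.sum_sub_distrib]
    -- The diagonal sum may start at k = 0 because its zeroth term vanishes; this aligns it with the
    -- sum shifted down by one.
    have e2 := Finset.sum_range_succ' (fun k : ℕ =>
      C (-((k : ℝ) * (k + α + β + 1)) * jacobiCoeff α β n k) * (X - 1 : ℝ[X]) ^ k) n
    rw [Finset.sum_range_succ] at e2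
    have e3 : ∑ k ∈ Finset.range n, C (-((k + 1) * (k + α + β + 2) : ℝ) *
          jacobiCoeff α β n (k + 1)) * (X - 1 : ℝ[X]) ^ (k + 1) =
        ∑ k ∈ Finset.range n, C (-(((k + 1 : ℕ) : ℝ) * ((k + 1 : ℕ) + α + β + 1)) *
          jacobiCoeff α β n (k + 1)) * (X - 1 : ℝ[X]) ^ (k + 1) := by
      refine Finset.sum_congr rfl fun k _ => ?_
      congr 3; push_cast; ring
    have e4 : C (-(((0 : ℕ) : ℝ) * ((0 : ℕ) + α + β + 1)) * jacobiCoeff α β n 0) *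
        (X - 1 : ℝ[X]) ^ 0 = 0 := by simp
    rw [e4, add_zero] at e2
    rw [e3, ← e2, add_sub_right_comm, ← Finset.sum_sub_distrib]
    congr 1
    · refine Finset.sum_congr rfl fun k _ => ?_
      rw [← sub_mul, ← C_sub, ← mul_assoc, ← C_mul]
      congr 2; ring
    · rw [← mul_assoc, ← C_mul]
  have h : jacobiP α β n = (((n + α).factorial : ℝ) / (n.factorial * (n + α + β).factorial)) •
      ∑ k ∈ Finset.range (n + 1), C (jacobiCoeff α β n k) * (X - 1) ^ k := by
    rw [smul_eq_C_mul]; rfl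
  have h2 : jacobiOp α β (jacobiP α β n) = jacobiOpL α β (jacobiP α β n) := rfl
  rw [h2, h, map_smul, key, mul_smul_comm]

theorem integral_weight_jacobiOp (α β : ℕ) (p q : ℝ[X]) :
    integral (weight α β * (jacobiOp α β p * q)) =
      -integral (weight (α + 1) (β + 1) * (derivative p * derivative q)) := by
  have h := integral_weight_succ_derivative α β (derivative p * q)
  rw [← mul_assoc, derivative_mul, derivative_weight, map_add, mul_assoc, mul_assoc] at h
  linarith

theorem integral_derivative_jacobiP (α β n : ℕ) (q : ℝ[X]) :
    integral (weight (α + 1) (β + 1) * (derivative (jacobiP α β n) * derivative q)) =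
      n * (n + α + β + 1) * integral (weight α β * (jacobiP α β n * q)) := by
  have h := integral_weight_jacobiOp α β (jacobiP α β n) q
  rw [jacobiOp_jacobiP, mul_assoc, mul_left_comm, integral_C_mul] at h
  linarith

/-- The linear functional `q ↦ ∫ w q`. -/
noncomputable def integralMul (w : ℝ[X]) : ℝ[X] →ₗ[ℝ] ℝ := integral ∘ₗ LinearMap.mulLeft ℝ w

theorem integralMul_apply (w q : ℝ[X]) : integralMul w q = integral (w * q) := rfl

/-- Symmetry lets the operator act on either factor. On (X - 1)^(k+1) it produces an eigenvalue
different from that of P_n, plus a multiple of (X - 1)^k that integrates to zero by induction. -/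
theorem integral_jacobiP_mul_pow (α β n : ℕ) :
    ∀ k < n, integral (weight α β * (jacobiP α β n * (X - 1) ^ k)) = 0 := by
  intro k
  induction k with
  | zero =>
    intro hn
    have h := integral_derivative_jacobiP α β n ((X - 1) ^ 0)
    have hn' : (0 : ℝ) < n := by exact_mod_cast hn
    rw [pow_zero, derivative_one, mul_zero, mul_zero, map_zero, eq_comm, mul_eq_zero] at h
    rcases h with h | h
    · have : (0 : ℝ) < n * (n + α + β + 1) := by positivity
      linarith
    · simpa using h
  | succ k ih =>
    intro hk
    have h0 := ih (by omega)
    have h1 := integral_derivative_jacobiP α β n ((X - 1) ^ (k + 1))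
    have h2 := integral_weight_jacobiOp α β ((X - 1) ^ (k + 1)) (jacobiP α β n)
    rw [mul_comm (derivative ((X - 1) ^ (k + 1))), h1, jacobiOp_pow_succ] at h2
    have h3 : weight α β * ((C (-((k + 1) * (k + α + β + 2) : ℝ)) * (X - 1) ^ (k + 1) -
        C (2 * (k + 1) * (k + 1 + α) : ℝ) * (X - 1) ^ k) * jacobiP α β n) =
        C (-((k + 1) * (k + α + β + 2) : ℝ)) * (weight α β * (jacobiP α β n * (X - 1) ^ (k + 1))) -
        C (2 * (k + 1) * (k + 1 + α) : ℝ) * (weight α β * (jacobiP α β n * (X - 1) ^ k)) := by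
      ring
    rw [h3, map_sub, integral_C_mul, integral_C_mul, h0] at h2
    have hkn : (k : ℝ) + 1 < n := by exact_mod_cast hk
    have h4 : ((n : ℝ) * (n + α + β + 1) - (k + 1) * (k + α + β + 2)) *
      integral (weight α β * (jacobiP α β n * (X - 1) ^ (k + 1))) = 0 := by linarith
    refine (mul_eq_zero.1 h4).resolve_left (ne_of_gt ?_)
    have h5 : ((n : ℝ) * (n + α + β + 1) - (k + 1) * (k + α + β + 2)) =
        (n - (k + 1)) * (n + k + α + β + 2) := by ring
    rw [h5]
    have : (0 : ℝ) < n - (k + 1) := by linarith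
    positivity

/-- Orthogonality of the Jacobi polynomials. -/
theorem integral_jacobiP_mul (α β n : ℕ) {q : ℝ[X]} (hq : q.degree < n) :
    integral (weight α β * (jacobiP α β n * q)) = 0 := by
  rw [← mul_assoc]
  refine map_eq_zero_of_shifted_powers (φ := integralMul (weight α β * jacobiP α β n))
    (fun k hk => ?_) hq
  rw [integralMul_apply, mul_assoc]
  exact integral_jacobiP_mul_pow α β n k hk

/-- Orthogonality of the derivatives of the Jacobi polynomials. -/
theorem integral_derivative_jacobiP_mul (α β n : ℕ) {q : ℝ[X]} (hq : q.degree < n) :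
    integral (weight (α + 1) (β + 1) * (derivative (jacobiP α β (n + 1)) * q)) = 0 := by
  rw [← mul_assoc]
  refine map_eq_zero_of_shifted_powers
    (φ := integralMul (weight (α + 1) (β + 1) * derivative (jacobiP α β (n + 1))))
    (fun k hk => ?_) hq
  rw [integralMul_apply, mul_assoc]
  have h := integral_derivative_jacobiP α β (n + 1) ((X - 1) ^ (k + 1))
  rw [integral_jacobiP_mul_pow α β (n + 1) (k + 1) (by omega), derivative_pow, derivative_sub,
    derivative_X, derivative_one, sub_zero, mul_one, Nat.add_sub_cancel, mul_left_comm
      (derivative (jacobiP α β (n + 1))), mul_left_comm, integral_C_mul, mul_zero] at h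
  exact (mul_eq_zero.1 h).resolve_left (by positivity)

/-! ### Normalization, degree and leading coefficient -/

theorem jacobiP_eval_one (β n : ℕ) : (jacobiP 0 β n).eval 1 = 1 := by
  have h1 : (n.factorial : ℝ) ≠ 0 := by positivity
  have h2 : ((n + β).factorial : ℝ) ≠ 0 := by positivity
  simp [jacobiP, eval_finsetSum, Finset.sum_range_succ']
  field_simp

theorem degree_C_mul_le_degree (c : ℝ) (p : ℝ[X]) : (C c * p).degree ≤ p.degree := by
  rw [← smul_eq_C_mul]; exact degree_smul_le c p

theorem degree_jacobi_sum_lt (α β n : ℕ) :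
    (∑ k ∈ Finset.range n, C (jacobiCoeff α β n k) * (X - 1 : ℝ[X]) ^ k).degree < n := by
  refine (degree_sum_le _ _).trans_lt ((Finset.sup_lt_iff (WithBot.bot_lt_coe n)).2 fun k hk => ?_)
  have h1 : ((X - 1 : ℝ[X]) ^ k).degree ≤ k := by
    rw [← C_1, degree_pow, degree_X_sub_C, nsmul_one]
  refine ((degree_C_mul_le_degree _ _).trans h1).trans_lt ?_
  exact Nat.cast_lt.2 (Finset.mem_range.1 hk)

/-- The leading coefficient of the Jacobi polynomial. -/
noncomputable def jacobiLead (α β n : ℕ) : ℝ :=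
  (2 * n + α + β).factorial / (2 ^ n * n.factorial * (n + α + β).factorial)

theorem jacobiLead_pos (α β n : ℕ) : 0 < jacobiLead α β n := by
  unfold jacobiLead; positivity

theorem degree_jacobiP_sub_lt (α β n : ℕ) :
    (jacobiP α β n - C (jacobiLead α β n) * X ^ n).degree < (n : WithBot ℕ) := by
  have h1 : (((X - 1 : ℝ[X]) ^ n) - X ^ n).degree < (n : WithBot ℕ) := by
    have hm : ((X - 1 : ℝ[X]) ^ n).Monic := by
      rw [← C_1]; exact (monic_X_sub_C 1).pow n
    have hd : ((X - 1 : ℝ[X]) ^ n).degree = n := by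
      rw [← C_1, degree_pow, degree_X_sub_C, nsmul_one]
    have := degree_sub_lt_left (p := (X - 1 : ℝ[X]) ^ n) (q := X ^ n) (by rw [hd, degree_X_pow])
      hm.ne_zero (by rw [hm.leadingCoeff, (monic_X_pow n).leadingCoeff])
    rwa [hd] at this
  set c : ℝ := ((n + α).factorial : ℝ) / (n.factorial * (n + α + β).factorial) with hc
  have h2 : jacobiP α β n = C c *
      ((∑ k ∈ Finset.range n, C (jacobiCoeff α β n k) * (X - 1 : ℝ[X]) ^ k) +
        C (jacobiCoeff α β n n) * (X - 1) ^ n) := by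
    rw [← Finset.sum_range_succ]; rfl
  have h3 : jacobiLead α β n = c * jacobiCoeff α β n n := by
    have : ((n + α).factorial : ℝ) ≠ 0 := by positivity
    simp only [hc, jacobiLead, jacobiCoeff, Nat.choose_self, two_mul]
    field_simp
    simp
  have h4 : jacobiP α β n - C (jacobiLead α β n) * X ^ n =
      C c * (∑ k ∈ Finset.range n, C (jacobiCoeff α β n k) * (X - 1 : ℝ[X]) ^ k) +
        C (jacobiLead α β n) * ((X - 1) ^ n - X ^ n) := by
    rw [h2, h3, C_mul]; ring
  rw [h4]
  refine (degree_add_le _ _).trans_lt (max_lt ?_ ?_)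
  · exact (degree_C_mul_le_degree _ _).trans_lt (degree_jacobi_sum_lt α β n)
  · exact (degree_C_mul_le_degree _ _).trans_lt h1

theorem coeff_jacobiP_self (α β n : ℕ) : (jacobiP α β n).coeff n = jacobiLead α β n := by
  have := coeff_eq_zero_of_degree_lt (degree_jacobiP_sub_lt α β n)
  rw [coeff_sub, coeff_C_mul, coeff_X_pow_self, mul_one] at this
  linarith

theorem degree_jacobiP (α β n : ℕ) : (jacobiP α β n).degree = n := by
  refine le_antisymm ?_ (le_degree_of_ne_zero ?_)
  · have h : jacobiP α β n = (jacobiP α β n - C (jacobiLead α β n) * X ^ n) +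
      C (jacobiLead α β n) * X ^ n := by ring
    rw [h]
    exact (degree_add_le _ _).trans (max_le (degree_jacobiP_sub_lt α β n).le
      (degree_C_mul_X_pow_le _ _))
  · rw [coeff_jacobiP_self]; exact (jacobiLead_pos α β n).ne'

theorem natDegree_jacobiP (α β n : ℕ) : (jacobiP α β n).natDegree = n :=
  natDegree_eq_of_degree_eq_some (degree_jacobiP α β n)

theorem jacobiP_ne_zero (α β n : ℕ) : jacobiP α β n ≠ 0 := by
  intro h
  have := degree_jacobiP α β n
  rw [h, degree_zero] at this
  exact absurd this (by simp)

/-! ### Zeros of orthogonal polynomials -/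

/-- `p` is an orthogonal polynomial of degree `n` for the weight `w` on `[-1, 1]`. -/
structure IsOrthogonalPoly (w : ℝ[X]) (n : ℕ) (p : ℝ[X]) : Prop where
  degree_eq : p.degree = n
  integral_eq_zero : ∀ q : ℝ[X], q.degree < n → integral (w * (p * q)) = 0

theorem isOrthogonalPoly_derivative_jacobiP (α β n : ℕ) :
    IsOrthogonalPoly (weight (α + 1) (β + 1)) n (derivative (jacobiP α β (n + 1))) := by
  refine ⟨?_, fun _ hq => integral_derivative_jacobiP_mul α β n hq⟩
  rw [degree_derivative (by rw [natDegree_jacobiP]; omega), natDegree_jacobiP]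
  rfl

namespace IsOrthogonalPoly

variable {w : ℝ[X]} {n : ℕ} {p : ℝ[X]}

theorem ne_zero (h : IsOrthogonalPoly w n p) : p ≠ 0 := by
  rintro rfl
  have := h.degree_eq
  rw [degree_zero] at this
  exact absurd this (by simp)

/-- An orthogonal polynomial has no nonconstant factor that is nonnegative on `(-1, 1)`. -/
theorem no_nonneg_factor {α β : ℕ} (h : IsOrthogonalPoly (weight α β) n p) {s q : ℝ[X]}
    (hp : p = s * q) (hs : 0 < s.degree) (hpos : ∀ x ∈ Set.Ioo (-1 : ℝ) 1, 0 ≤ s.eval x) :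
    False := by
  have hsq := hp ▸ h.ne_zero
  have hs0 : s ≠ 0 := left_ne_zero_of_mul hsq
  have hq0 : q ≠ 0 := right_ne_zero_of_mul hsq
  have hq : q.degree < n := by
    rw [← h.degree_eq, hp, degree_mul, degree_eq_natDegree hq0, degree_eq_natDegree hs0]
    rw [degree_eq_natDegree hs0] at hs
    norm_cast at hs ⊢
    omega
  -- Testing against the cofactor makes the integrand w s q², nonnegative and not identically zero.
  have h0 := h.integral_eq_zero q hq
  refine absurd h0 (ne_of_gt (integral_pos ?_ fun x hx => ?_))
  · exact mul_ne_zero (weight_ne_zero α β) (mul_ne_zero h.ne_zero hq0)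
  · rw [hp, mul_assoc, eval_mul, eval_mul, eval_mul]
    exact mul_nonneg (weight_eval_nonneg α β hx) (mul_nonneg (hpos x hx) (mul_self_nonneg _))

/-- Without a zero the factor would keep one sign on (-1, 1), by the intermediate value theorem, and
it or its negative would contradict `no_nonneg_factor`. -/
theorem exists_root_of_dvd {α β : ℕ} (h : IsOrthogonalPoly (weight α β) n p) {s : ℝ[X]}
    (hp : s ∣ p) (hs : 0 < s.degree) : ∃ x ∈ Set.Ioo (-1 : ℝ) 1, s.eval x = 0 := by
  obtain ⟨q, hq⟩ := hp
  by_contra! hne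
  have hpre : IsPreconnected (Set.Ioo (-1 : ℝ) 1) := isPreconnected_Ioo
  by_cases hpos : ∀ x ∈ Set.Ioo (-1 : ℝ) 1, 0 ≤ s.eval x
  · exact h.no_nonneg_factor hq hs hpos
  by_cases hneg : ∀ x ∈ Set.Ioo (-1 : ℝ) 1, s.eval x ≤ 0
  · refine h.no_nonneg_factor (s := -s) (q := -q) (by rw [hq]; ring) (by rwa [degree_neg])
      fun x hx => ?_
    rw [eval_neg]
    linarith [hneg x hx]
  push Not at hpos hneg
  obtain ⟨a, ha, ha'⟩ := hpos
  obtain ⟨b, hb, hb'⟩ := hneg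
  obtain ⟨c, hc, hc'⟩ := hpre.intermediate_value ha hb s.continuous.continuousOn
    (show (0 : ℝ) ∈ Set.Icc _ _ from ⟨ha'.le, hb'.le⟩)
  exact hne c hc hc'

theorem splits {α β : ℕ} (h : IsOrthogonalPoly (weight α β) n p) : p.Splits := by
  refine splits_iff_splits.2 (Or.inr fun {g} hg hgp => ?_)
  obtain ⟨x, _, hx⟩ := h.exists_root_of_dvd hgp (degree_pos_of_irreducible hg)
  exact degree_eq_one_of_irreducible_of_root hg hx

theorem mem_Ioo_of_mem_roots {α β : ℕ} (h : IsOrthogonalPoly (weight α β) n p) {x : ℝ}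
    (hx : x ∈ p.roots) : x ∈ Set.Ioo (-1 : ℝ) 1 := by
  obtain ⟨y, hy, hy'⟩ := h.exists_root_of_dvd (dvd_iff_isRoot.2 (isRoot_of_mem_roots hx))
    (by rw [degree_X_sub_C]; exact one_pos)
  rw [eval_sub, eval_X, eval_C, sub_eq_zero] at hy'
  rwa [← hy']

theorem nodup_roots {α β : ℕ} (h : IsOrthogonalPoly (weight α β) n p) : p.roots.Nodup := by
  rw [Multiset.nodup_iff_count_le_one]
  intro x
  by_contra! hc
  rw [count_roots] at hc
  obtain ⟨q, hq⟩ := (le_rootMultiplicity_iff h.ne_zero).1 hc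
  refine h.no_nonneg_factor hq ?_ fun y _ => ?_
  · rw [degree_pow, degree_X_sub_C]; norm_num
  · rw [eval_pow]; exact Even.pow_nonneg (by norm_num) _

end IsOrthogonalPoly

/-! ### Lobatto nodes and the exact quadrature rule -/

section Lobatto

variable (α β n : ℕ)

theorem lobattoPoly_ne_zero : lobattoPoly α β (n + 1) ≠ 0 := by
  refine mul_ne_zero (fun h => ?_) (isOrthogonalPoly_derivative_jacobiP α β n).ne_zero
  have := congrArg (eval 0) h
  simp at this

theorem roots_lobattoPoly : (lobattoPoly α β (n + 1)).roots =
    {1} + {-1} + (derivative (jacobiP α β (n + 1))).roots := by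
  have h : lobattoPoly α β (n + 1) =
      -(((X - C 1) * (X - C (-1))) * derivative (jacobiP α β (n + 1))) := by
    rw [lobattoPoly, C_neg, C_1]; ring
  have h0 := lobattoPoly_ne_zero α β n
  rw [h, neg_ne_zero] at h0
  rw [h, roots_neg, roots_mul h0, roots_mul (left_ne_zero_of_mul h0), roots_X_sub_C, roots_X_sub_C]

theorem nodup_roots_lobattoPoly : (lobattoPoly α β (n + 1)).roots.Nodup := by
  have h := isOrthogonalPoly_derivative_jacobiP α β n
  have h1 : (1 : ℝ) ∉ (derivative (jacobiP α β (n + 1))).roots := fun h' =>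
    lt_irrefl _ (h.mem_Ioo_of_mem_roots h').2
  have h2 : (-1 : ℝ) ∉ (derivative (jacobiP α β (n + 1))).roots := fun h' =>
    lt_irrefl _ (h.mem_Ioo_of_mem_roots h').1
  rw [roots_lobattoPoly, add_assoc, Multiset.singleton_add, Multiset.singleton_add,
    Multiset.nodup_cons, Multiset.nodup_cons]
  refine ⟨?_, h2, h.nodup_roots⟩
  rw [Multiset.mem_cons, not_or]
  exact ⟨by norm_num, h1⟩

theorem card_roots_lobattoPoly : (lobattoPoly α β (n + 1)).roots.toFinset.card = n + 2 := by
  have h := isOrthogonalPoly_derivative_jacobiP α β n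
  rw [Multiset.toFinset_card_of_nodup (nodup_roots_lobattoPoly α β n), roots_lobattoPoly,
    Multiset.card_add, ← h.splits.natDegree_eq_card_roots, natDegree_eq_of_degree_eq_some
      h.degree_eq]
  simp only [Multiset.card_add, Multiset.card_singleton]
  omega

theorem natDegree_lobattoPoly : (lobattoPoly α β (n + 1)).natDegree = n + 2 := by
  have h1 : (1 - X ^ 2 : ℝ[X]).natDegree = 2 := by compute_degree!
  have h0 := lobattoPoly_ne_zero α β n
  rw [lobattoPoly, natDegree_mul (left_ne_zero_of_mul h0) (right_ne_zero_of_mul h0), h1,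
    natDegree_eq_of_degree_eq_some (isOrthogonalPoly_derivative_jacobiP α β n).degree_eq]
  omega

theorem splits_lobattoPoly : (lobattoPoly α β (n + 1)).Splits := by
  rw [splits_iff_card_roots, natDegree_lobattoPoly, ← card_roots_lobattoPoly,
    Multiset.toFinset_card_of_nodup (nodup_roots_lobattoPoly α β n)]

theorem lobattoNode_eq_orderEmbOfFin (i : Fin (n + 1 + 1)) :
    lobattoNode α β (n + 1) i =
      (lobattoPoly α β (n + 1)).roots.toFinset.orderEmbOfFin (card_roots_lobattoPoly α β n) i := by
  rw [Finset.orderEmbOfFin_apply, lobattoNode, List.getD_eq_getElem]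
  rfl

theorem lobattoNode_strictMono : StrictMono (lobattoNode α β (n + 1)) := by
  intro i j hij
  rw [lobattoNode_eq_orderEmbOfFin, lobattoNode_eq_orderEmbOfFin]
  exact (Finset.orderEmbOfFin _ _).strictMono hij

theorem lobattoNode_injective : Function.Injective (lobattoNode α β (n + 1)) :=
  (lobattoNode_strictMono α β n).injective

theorem lobattoNode_mem (i : Fin (n + 1 + 1)) :
    lobattoNode α β (n + 1) i ∈ (lobattoPoly α β (n + 1)).roots := by
  rw [lobattoNode_eq_orderEmbOfFin, ← Multiset.mem_toFinset]
  exact Finset.orderEmbOfFin_mem _ _ _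

theorem lobattoPoly_eval_node (i : Fin (n + 1 + 1)) :
    (lobattoPoly α β (n + 1)).eval (lobattoNode α β (n + 1) i) = 0 :=
  isRoot_of_mem_roots (lobattoNode_mem α β n i)

theorem exists_lobattoNode_eq {x : ℝ} (hx : x ∈ (lobattoPoly α β (n + 1)).roots) :
    ∃ i, lobattoNode α β (n + 1) i = x := by
  rw [← Multiset.mem_toFinset, ← Finset.mem_coe,
    ← Finset.range_orderEmbOfFin _ (card_roots_lobattoPoly α β n)] at hx
  obtain ⟨i, hi⟩ := hx
  exact ⟨i, by rw [lobattoNode_eq_orderEmbOfFin, hi]⟩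

theorem roots_lobattoPoly_eq_map : (lobattoPoly α β (n + 1)).roots =
    (Finset.univ : Finset (Fin (n + 1 + 1))).val.map (lobattoNode α β (n + 1)) := by
  refine (Multiset.Nodup.ext (nodup_roots_lobattoPoly α β n)
    (Finset.univ.nodup.map (lobattoNode_injective α β n))).2 fun x => ?_
  rw [Multiset.mem_map]
  constructor
  · intro hx
    obtain ⟨i, hi⟩ := exists_lobattoNode_eq α β n hx
    exact ⟨i, Finset.mem_univ i, hi⟩
  · rintro ⟨i, -, rfl⟩
    exact lobattoNode_mem α β n i

theorem lobattoNode_mem_Icc (i : Fin (n + 1 + 1)) :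
    lobattoNode α β (n + 1) i ∈ Set.Icc (-1 : ℝ) 1 := by
  have h := lobattoNode_mem α β n i
  rw [roots_lobattoPoly, Multiset.mem_add, Multiset.mem_add, Multiset.mem_singleton,
    Multiset.mem_singleton] at h
  rcases h with (h | h) | h
  · rw [h]; norm_num
  · rw [h]; norm_num
  · exact Set.Ioo_subset_Icc_self
      ((isOrthogonalPoly_derivative_jacobiP α β n).mem_Ioo_of_mem_roots h)

theorem lobattoNode_zero : lobattoNode α β (n + 1) 0 = -1 := by
  obtain ⟨i, hi⟩ := exists_lobattoNode_eq α β n (x := -1) (by rw [roots_lobattoPoly]; simp)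
  refine le_antisymm ?_ (lobattoNode_mem_Icc α β n 0).1
  rw [← hi]
  exact (lobattoNode_strictMono α β n).monotone (Fin.zero_le i)

theorem neg_one_lt_lobattoNode {i : Fin (n + 1 + 1)} (hi : i ≠ 0) :
    -1 < lobattoNode α β (n + 1) i := by
  rw [← lobattoNode_zero α β n]
  exact lobattoNode_strictMono α β n (Fin.pos_of_ne_zero hi)

theorem isLobattoWeights_iff {N : ℕ} {ρ : Fin (N + 1) → ℝ} : IsLobattoWeights α β N ρ ↔
    ∀ u : ℝ[X], u.natDegree ≤ 2 * N - 1 →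
      integral (u * weight α β) = ∑ i, u.eval (lobattoNode α β N i) * ρ i := by
  simp only [IsLobattoWeights, integral_apply, weight, eval_mul, eval_pow, eval_sub, eval_add,
    eval_one, eval_X]

/-- The weights are the integrals of the Lagrange basis. Divide u by the nodal polynomial: the
remainder is interpolated exactly, and the quotient term integrates to zero because (1 - x²)P' times
the weight is P' times the raised weight, for which P' is orthogonal. -/
theorem exists_isLobattoWeights : ∃ ρ, IsLobattoWeights α β (n + 1) ρ := by
  refine ⟨fun i => integral (Lagrange.basis Finset.univ (lobattoNode α β (n + 1)) i *
    weight α β), (isLobattoWeights_iff α β).2 fun u hu => ?_⟩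
  set ω := lobattoPoly α β (n + 1) with hω
  have hω0 : ω ≠ 0 := lobattoPoly_ne_zero α β n
  have hωd : ω.natDegree = n + 2 := natDegree_lobattoPoly α β n
  have hωd' : ω.degree = ((n + 2 : ℕ) : WithBot ℕ) := by rw [degree_eq_natDegree hω0, hωd]
  have hdiv : ω * (u / ω) + u % ω = u := EuclideanDomain.div_add_mod u ω
  have hr : (u % ω).degree < ((n + 2 : ℕ) : WithBot ℕ) := hωd' ▸ degree_mod_lt u hω0
  -- Degree count: (2n + 1) - (n + 2) = n - 1.
  have hq : (u / ω).degree < n := by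
    rcases eq_or_ne (u / ω) 0 with h | h
    · rw [h, degree_zero]; exact WithBot.bot_lt_coe _
    · have h1 : ω.degree ≤ u.degree := by
        by_contra! h1
        exact h ((Polynomial.div_eq_zero_iff hω0).2 h1)
      have h2 := degree_add_div hω0 h1
      have hu0 : u ≠ 0 := by
        rintro rfl; exact h (EuclideanDomain.zero_div)
      rw [degree_eq_natDegree hω0, degree_eq_natDegree h, degree_eq_natDegree hu0, hωd] at h2
      rw [degree_eq_natDegree h]
      norm_cast at h2 ⊢
      omega
  have h0 : integral (ω * (u / ω) * weight α β) = 0 := by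
    have h := (isOrthogonalPoly_derivative_jacobiP α β n).integral_eq_zero _ hq
    have h' : ω * (u / ω) * weight α β =
        weight (α + 1) (β + 1) * (derivative (jacobiP α β (n + 1)) * (u / ω)) := by
      rw [hω, lobattoPoly, weight, weight]; ring
    rw [h', h]
  have h1 : u % ω = ∑ i, C (u.eval (lobattoNode α β (n + 1) i)) *
      Lagrange.basis Finset.univ (lobattoNode α β (n + 1)) i := by
    have h2 := Lagrange.eq_interpolate_of_eval_eq (s := Finset.univ)
      (f := u % ω) (v := lobattoNode α β (n + 1))
      (fun i => u.eval (lobattoNode α β (n + 1) i)) (lobattoNode_injective α β n).injOn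
      (by rw [Finset.card_fin]; exact hr) (fun i _ => by
        conv_rhs => rw [← hdiv]
        rw [eval_add, eval_mul, hω, lobattoPoly_eval_node, zero_mul, zero_add])
    rw [h2, Lagrange.interpolate_apply]
  conv_lhs => rw [← hdiv, add_mul, map_add, h0, zero_add, h1, Finset.sum_mul, map_sum]
  refine Finset.sum_congr rfl fun i _ => ?_
  rw [mul_assoc, integral_C_mul]

theorem isLobattoWeights_lobattoWeight :
    IsLobattoWeights α β (n + 1) (lobattoWeight α β (n + 1)) :=
  Classical.epsilon_spec (exists_isLobattoWeights α β n)

/-- Exactness of the Gauss-Lobatto quadrature rule. -/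
theorem sum_lobattoWeight {u : ℝ[X]} (hu : u.natDegree ≤ 2 * n + 1) :
    ∑ i, u.eval (lobattoNode α β (n + 1) i) * lobattoWeight α β (n + 1) i =
      integral (u * weight α β) :=
  ((isLobattoWeights_iff α β).1 (isLobattoWeights_lobattoWeight α β n) u (by omega)).symm

end Lobatto

/-! ### Identities for L_n and P_n^{(0,1)} -/

@[simp] theorem weight_zero_zero : weight 0 0 = 1 := by simp [weight]
@[simp] theorem weight_zero_one : weight 0 1 = 1 + X := by simp [weight]

theorem exists_eq_jacobiP_add (α β n : ℕ) {u : ℝ[X]} (hu : u.degree < (n + 1 : ℕ)) :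
    ∃ r : ℝ[X], u = C (u.coeff n / jacobiLead α β n) * jacobiP α β n + r ∧ r.degree < n := by
  refine ⟨u - C (u.coeff n / jacobiLead α β n) * jacobiP α β n, by ring, ?_⟩
  rw [degree_lt_iff_coeff_zero] at hu ⊢
  intro m hm
  rw [coeff_sub, coeff_C_mul]
  rcases hm.eq_or_lt with rfl | hm
  · rw [coeff_jacobiP_self, div_mul_cancel₀ _ (jacobiLead_pos α β n).ne', sub_self]
  · rw [hu m hm, coeff_eq_zero_of_natDegree_lt (p := jacobiP α β n)
      (by rwa [natDegree_jacobiP]), mul_zero, sub_zero]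

theorem eq_zero_of_integral_mul_eq_zero {α β n : ℕ} {u : ℝ[X]} (hu : u.degree < n)
    (h : ∀ q : ℝ[X], q.degree < n → integral (weight α β * (u * q)) = 0) : u = 0 := by
  by_contra h0
  refine (integral_pos (mul_ne_zero (weight_ne_zero α β) (mul_ne_zero h0 h0))
    fun x hx => ?_).ne' (h u hu)
  rw [eval_mul, eval_mul]
  exact mul_nonneg (weight_eval_nonneg α β hx) (mul_self_nonneg _)

/-- Orthogonal polynomials are unique up to normalization. -/
theorem IsOrthogonalPoly.eq_C_mul_jacobiP {α β n : ℕ} {p : ℝ[X]}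
    (h : IsOrthogonalPoly (weight α β) n p) :
    p = C (p.coeff n / jacobiLead α β n) * jacobiP α β n := by
  obtain ⟨r, hr, hr'⟩ := exists_eq_jacobiP_add α β n (u := p)
    (by rw [h.degree_eq]; exact_mod_cast Nat.lt_succ_self n)
  suffices r = 0 by rwa [this, add_zero] at hr
  refine eq_zero_of_integral_mul_eq_zero (α := α) (β := β) hr' fun q hq => ?_
  have h1 := h.integral_eq_zero q hq
  have h2 := integral_jacobiP_mul α β n hq
  rw [hr, add_mul, mul_add, map_add, mul_assoc, mul_left_comm, integral_C_mul, h2] at h1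
  simpa using h1

/-- The Legendre polynomials. -/
noncomputable abbrev legendre (n : ℕ) : ℝ[X] := jacobiP 0 0 n

/-- The Jacobi polynomials `P_n^{(0, 1)}`. -/
noncomputable abbrev jacobiOne (n : ℕ) : ℝ[X] := jacobiP 0 1 n

theorem integral_legendre_mul {n : ℕ} {q : ℝ[X]} (hq : q.degree < n) :
    integral (legendre n * q) = 0 := by
  simpa using integral_jacobiP_mul 0 0 n hq

/-- Reflection preserves orthogonality, so uniqueness leaves only a scalar, read off from leading
coefficients. -/
theorem legendre_comp_neg (n : ℕ) :
    (legendre n).comp (-X) = C ((-1) ^ n) * legendre n := by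
  have h : IsOrthogonalPoly (weight 0 0) n ((legendre n).comp (-X)) := by
    refine ⟨?_, fun q hq => ?_⟩
    · rw [degree_eq_natDegree, natDegree_comp, natDegree_neg, natDegree_X, mul_one,
        natDegree_jacobiP]
      intro h
      have h' := congrArg (fun p => p.comp (-X)) h
      simp only [comp_assoc, neg_comp, X_comp, neg_neg, comp_X, zero_comp] at h'
      exact jacobiP_ne_zero 0 0 n h'
    · rw [weight_zero_zero, one_mul, ← integral_comp_neg, mul_comp, comp_assoc, neg_comp, X_comp,
        neg_neg, comp_X]
      refine integral_legendre_mul (lt_of_le_of_lt ?_ hq)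
      rcases eq_or_ne q 0 with rfl | h0
      · simp
      · refine degree_le_of_natDegree_le ?_ |>.trans (degree_eq_natDegree h0).ge
        rw [natDegree_comp, natDegree_neg, natDegree_X, mul_one]
  have h1 := h.eq_C_mul_jacobiP
  have h2 : ((legendre n).comp (-X)).coeff n = (-1) ^ n * jacobiLead 0 0 n := by
    have h3 := leadingCoeff_comp (p := legendre n) (q := (-X : ℝ[X])) (by simp)
    rw [leadingCoeff, natDegree_comp, natDegree_neg, natDegree_X, mul_one, leadingCoeff_neg,
      leadingCoeff_X, leadingCoeff, natDegree_jacobiP, coeff_jacobiP_self] at h3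
    rw [h3, mul_comm]
  rwa [h2, mul_div_assoc,
    div_self (jacobiLead_pos 0 0 n).ne', mul_one] at h1

theorem legendre_eval_one (n : ℕ) : (legendre n).eval 1 = 1 := jacobiP_eval_one 0 n

theorem legendre_eval_neg_one (n : ℕ) : (legendre n).eval (-1) = (-1) ^ n := by
  have h := congrArg (eval 1) (legendre_comp_neg n)
  simpa [legendre_eval_one] using h

/-- At -1 the second-order term of the Jacobi equation drops out. -/
theorem derivative_jacobiP_eval_neg_one (α β n : ℕ) :
    (2 * β + 2) * (derivative (jacobiP α β n)).eval (-1) =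
      -(n * (n + α + β + 1)) * (jacobiP α β n).eval (-1) := by
  have h := congrArg (eval (-1)) (jacobiOp_jacobiP α β n)
  simp only [jacobiOp, eval_add, eval_mul, eval_sub, eval_one, eval_pow, eval_X, eval_C] at h
  linear_combination h

theorem derivative_legendre_eval_neg_one (n : ℕ) :
    (derivative (legendre n)).eval (-1) = -(n * (n + 1) / 2) * (-1) ^ n := by
  have h := derivative_jacobiP_eval_neg_one 0 0 n
  rw [legendre_eval_neg_one] at h
  push_cast at h
  linear_combination h / 2

theorem degree_X_mul_derivative_sub_lt (n : ℕ) :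
    (X * derivative (legendre n) - C (n : ℝ) * legendre n).degree < (n : WithBot ℕ) := by
  rw [degree_lt_iff_coeff_zero]
  intro m hm
  have h1 : (X * derivative (legendre n)).coeff m = m * (legendre n).coeff m := by
    rcases m with _ | m
    · simp
    · rw [coeff_X_mul, coeff_derivative]; push_cast; ring
  rw [coeff_sub, h1, coeff_C_mul]
  rcases hm.eq_or_lt with rfl | hm
  · ring
  · rw [coeff_eq_zero_of_natDegree_lt (by rwa [natDegree_jacobiP])]; ring

/-- Integrate (x L_n²)' = L_n² + 2 L_n · x L_n', where x L_n' is n L_n plus lower order terms. -/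
theorem integral_legendre_sq (n : ℕ) :
    integral (legendre n * legendre n) = 2 / (2 * n + 1) := by
  have h1 := integral_derivative (X * (legendre n * legendre n))
  have h2 := integral_legendre_mul (degree_X_mul_derivative_sub_lt n)
  have h3 : derivative (X * (legendre n * legendre n)) =
      C (2 * n + 1 : ℝ) * (legendre n * legendre n) +
        C 2 * (legendre n * (X * derivative (legendre n) - C (n : ℝ) * legendre n)) := by
    simp only [derivative_mul, derivative_X, C_add, C_mul, C_1, map_ofNat]
    ring
  have h4 : ((-1 : ℝ) ^ n) * (-1) ^ n = 1 := by rw [← mul_pow]; simp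
  rw [h3, map_add, integral_C_mul, integral_C_mul, h2] at h1
  simp only [eval_mul, eval_X, legendre_eval_one, legendre_eval_neg_one, h4] at h1
  rw [eq_div_iff (by positivity)]
  linarith

theorem integral_legendre_mul_eq {n : ℕ} {u : ℝ[X]} (hu : u.degree < (n + 1 : ℕ)) :
    integral (legendre n * u) = u.coeff n / jacobiLead 0 0 n * (2 / (2 * n + 1)) := by
  obtain ⟨r, hr, hr'⟩ := exists_eq_jacobiP_add 0 0 n hu
  conv_lhs => rw [hr]
  rw [mul_add, map_add, integral_legendre_mul hr', mul_left_comm, integral_C_mul,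
    integral_legendre_sq, add_zero]

theorem jacobiLead_succ (n : ℕ) :
    jacobiLead 0 0 (n + 1) * (n + 1) = (2 * n + 1) * jacobiLead 0 0 n := by
  simp only [jacobiLead, add_zero]
  rw [show 2 * (n + 1) = 2 * n + 1 + 1 by ring, Nat.factorial_succ, Nat.factorial_succ,
    Nat.factorial_succ]
  have : (n.factorial : ℝ) ≠ 0 := by positivity
  push_cast
  field_simp
  ring

theorem jacobiLead_zero_one (n : ℕ) : jacobiLead 0 1 n = jacobiLead 0 0 (n + 1) := by
  simp only [jacobiLead, add_zero]
  rw [show 2 * (n + 1) = 2 * n + 1 + 1 by ring, Nat.factorial_succ (2 * n + 1),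
    Nat.factorial_succ n]
  have : (n.factorial : ℝ) ≠ 0 := by positivity
  push_cast
  field_simp
  ring

/-- L_n + L_{n+1} vanishes at -1, and its quotient by 1 + x is orthogonal for the weight 1 + x; the
values at 1 fix the scalar. -/
theorem one_add_X_mul_jacobiOne (n : ℕ) :
    (1 + X) * jacobiOne n = legendre n + legendre (n + 1) := by
  have hroot : (legendre n + legendre (n + 1)).IsRoot (-1) := by
    rw [IsRoot, eval_add, legendre_eval_neg_one, legendre_eval_neg_one]; ring
  obtain ⟨g, hg⟩ := dvd_iff_isRoot.2 hroot
  have hX : (X - C (-1) : ℝ[X]) = 1 + X := by rw [C_neg, C_1]; ring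
  rw [hX] at hg
  have hX0 : (1 + X : ℝ[X]) ≠ 0 := by
    rw [← hX]; exact X_sub_C_ne_zero _
  have hdeg : ((1 + X) * g).degree = ((n + 1 : ℕ) : WithBot ℕ) := by
    rw [← hg, degree_add_eq_right_of_degree_lt, degree_jacobiP]
    rw [degree_jacobiP, degree_jacobiP]
    exact_mod_cast Nat.lt_succ_self n
  have hg0 : g ≠ 0 := by
    rintro rfl
    rw [mul_zero, degree_zero] at hdeg
    exact WithBot.bot_ne_coe hdeg
  have hgd : g.degree = n := by
    rw [degree_mul, ← hX, degree_X_sub_C, degree_eq_natDegree hg0] at hdeg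
    rw [degree_eq_natDegree hg0]
    norm_cast at hdeg ⊢
    omega
  have h : IsOrthogonalPoly (weight 0 1) n g := by
    refine ⟨hgd, fun q hq => ?_⟩
    rw [weight_zero_one, ← mul_assoc, ← hg, add_mul, map_add, integral_legendre_mul hq,
      integral_legendre_mul (hq.trans (by exact_mod_cast Nat.lt_succ_self n)), add_zero]
  have h1 := h.eq_C_mul_jacobiP
  set c := g.coeff n / jacobiLead 0 1 n
  have h2 := congrArg (eval 1) hg
  rw [h1] at h2
  simp only [eval_add, eval_mul, eval_one, eval_X, eval_C,
    jacobiP_eval_one] at h2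
  have hc : c = 1 := by linarith
  rw [hg, h1, hc, C_1, one_mul]

theorem jacobiOne_eval_neg_one (n : ℕ) : (jacobiOne n).eval (-1) = (-1) ^ n * (n + 1) := by
  have h := congrArg (fun p => (derivative p).eval (-1)) (one_add_X_mul_jacobiOne n)
  simp only [derivative_mul, derivative_add, derivative_one, derivative_X, eval_add, eval_mul,
    eval_one, eval_X, eval_zero, derivative_legendre_eval_neg_one] at h
  push_cast at h
  rw [pow_succ] at h
  linear_combination h

theorem derivative_jacobiOne_eval_neg_one (n : ℕ) :
    (derivative (jacobiOne n)).eval (-1) = -(n * (n + 1) * (n + 2) / 4) * (-1) ^ n := by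
  have h := derivative_jacobiP_eval_neg_one 0 1 n
  rw [jacobiOne_eval_neg_one] at h
  push_cast at h
  linear_combination h / 4

theorem degree_jacobiP_lt (α β n : ℕ) : (jacobiP α β n).degree < (n + 1 : ℕ) := by
  rw [degree_jacobiP]; exact_mod_cast Nat.lt_succ_self n

theorem integral_legendre_mul_jacobiOne (n : ℕ) :
    integral (legendre n * jacobiOne n) = 2 / (n + 1) := by
  rw [integral_legendre_mul_eq (degree_jacobiP_lt 0 1 n), coeff_jacobiP_self, jacobiLead_zero_one]
  have h := jacobiLead_succ n
  have h0 := (jacobiLead_pos 0 0 n).ne'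
  field_simp
  linear_combination h

theorem integral_jacobiOne_sq (n : ℕ) :
    integral ((1 + X) * (jacobiOne n * jacobiOne n)) = 2 / (n + 1) := by
  rw [← mul_assoc, one_add_X_mul_jacobiOne, add_mul, map_add, integral_legendre_mul_jacobiOne,
    integral_legendre_mul (degree_jacobiP_lt 0 1 n), add_zero]

/-- As u - u(-1) is divisible by 1 + x, orthogonality kills it: against the unweighted measure,
P_n^{(0,1)} acts as a multiple of evaluation at -1. -/
theorem integral_mul_jacobiOne {n : ℕ} {u : ℝ[X]} (hu : u.degree < (n + 1 : ℕ)) :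
    integral (u * jacobiOne n) = u.eval (-1) * integral (jacobiOne n) := by
  obtain ⟨v, hv⟩ := X_sub_C_dvd_sub_C_eval (a := -1) (p := u)
  have hX : (X - C (-1) : ℝ[X]) = 1 + X := by rw [C_neg, C_1]; ring
  have hu' : u = C (u.eval (-1)) + (1 + X) * v := by rw [← hX, ← hv]; ring
  have hvd : v.degree < n := by
    rcases eq_or_ne v 0 with rfl | h0
    · rw [degree_zero]; exact WithBot.bot_lt_coe _
    · have h1 : ((X - C (-1)) * v).degree < ((n + 1 : ℕ) : WithBot ℕ) := by
        rw [← hv]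
        refine (degree_sub_le _ _).trans_lt (max_lt hu (degree_C_le.trans_lt ?_))
        exact_mod_cast Nat.succ_pos n
      rw [degree_mul, degree_X_sub_C, degree_eq_natDegree h0] at h1
      rw [degree_eq_natDegree h0]
      norm_cast at h1 ⊢
      omega
  have h2 := integral_jacobiP_mul 0 1 n hvd
  rw [weight_zero_one] at h2
  conv_lhs => rw [hu']
  rw [add_mul, map_add, integral_C_mul, mul_assoc, mul_comm v, h2, add_zero]

theorem neg_one_pow_mul_self (n : ℕ) : (-1 : ℝ) ^ n * (-1) ^ n = 1 := by
  rw [← mul_pow]; simp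

theorem integral_jacobiOne (n : ℕ) : integral (jacobiOne n) = (-1) ^ n * (2 / (n + 1)) := by
  have h := integral_mul_jacobiOne (degree_jacobiP_lt 0 0 n)
  rw [integral_legendre_mul_jacobiOne, legendre_eval_neg_one] at h
  linear_combination (-(-1) ^ n : ℝ) * h - integral (jacobiOne n) * neg_one_pow_mul_self n

theorem integral_X_mul_legendre_sq (n : ℕ) :
    integral (X * (legendre n * legendre n)) = 0 := by
  have h := integral_comp_neg (X * (legendre n * legendre n))
  rw [mul_comp, mul_comp, legendre_comp_neg, X_comp] at h
  have h1 : -X * (C ((-1) ^ n) * legendre n * (C ((-1) ^ n) * legendre n)) =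
      -(C ((-1 : ℝ) ^ n * (-1) ^ n) * (X * (legendre n * legendre n))) := by
    rw [C_mul]; ring
  rw [h1, neg_one_pow_mul_self, C_1, one_mul, map_neg] at h
  linarith

theorem degree_X_mul_lt {q : ℝ[X]} {n : ℕ} (hq : q.degree < n) :
    (X * q).degree < ((n + 1 : ℕ) : WithBot ℕ) := by
  rcases eq_or_ne q 0 with rfl | h0
  · rw [mul_zero, degree_zero]; exact WithBot.bot_lt_coe _
  · rw [degree_mul, degree_X, degree_eq_natDegree h0]
    rw [degree_eq_natDegree h0] at hq
    norm_cast at hq ⊢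
    omega

/-- The difference d of the two sides has degree at most n + 1 and is orthogonal to degrees below n,
so d = a L_{n+1} + b L_n. Vanishing at both endpoints forces a = b = 0. -/
theorem X_sq_sub_one_mul_derivative_legendre (n : ℕ) :
    (X ^ 2 - 1) * derivative (legendre (n + 1)) =
      C (n + 1 : ℝ) * (X * legendre (n + 1) - legendre n) := by
  set d := C (n + 1 : ℝ) * (X * legendre (n + 1) - legendre n) -
    (X ^ 2 - 1) * derivative (legendre (n + 1)) with hd
  have hdd : d.degree < (n + 1 + 1 : ℕ) := by
    have h1 := degree_X_mul_lt (degree_X_mul_derivative_sub_lt (n + 1))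
    have h2 : d = -(X * (X * derivative (legendre (n + 1)) -
        C ((n + 1 : ℕ) : ℝ) * legendre (n + 1))) +
        (derivative (legendre (n + 1)) - C (n + 1 : ℝ) * legendre n) := by
      rw [hd]; push_cast; ring
    rw [h2]
    refine (degree_add_le _ _).trans_lt (max_lt (by rwa [degree_neg]) ?_)
    refine (degree_sub_le _ _).trans_lt (max_lt ?_ ?_)
    · exact (degree_derivative_le.trans_lt (degree_jacobiP_lt 0 0 (n + 1)))
    · refine (degree_C_mul_le_degree _ _).trans_lt ((degree_jacobiP_lt 0 0 n).trans ?_)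
      exact_mod_cast Nat.lt_succ_self _
  obtain ⟨s, hs, hs'⟩ := exists_eq_jacobiP_add 0 0 (n + 1) hdd
  obtain ⟨r, hr, hr'⟩ := exists_eq_jacobiP_add 0 0 n hs'
  set a := d.coeff (n + 1) / jacobiLead 0 0 (n + 1)
  set b := s.coeff n / jacobiLead 0 0 n
  have hlt : ((n : ℕ) : WithBot ℕ) < (n + 1 : ℕ) := by exact_mod_cast Nat.lt_succ_self n
  have hr0 : r = 0 := by
    refine eq_zero_of_integral_mul_eq_zero (α := 0) (β := 0) hr' fun q hq => ?_
    have e1 := integral_legendre_mul (hq.trans hlt)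
    have e2 := integral_legendre_mul hq
    have e3 := integral_legendre_mul (degree_X_mul_lt hq)
    have e4 := (isOrthogonalPoly_derivative_jacobiP 0 0 n).integral_eq_zero q hq
    have e5 : weight 0 0 * (r * q) = C (n + 1 : ℝ) * (legendre (n + 1) * (X * q)) -
        C (n + 1 : ℝ) * (legendre n * q) +
        weight (0 + 1) (0 + 1) * (derivative (legendre (n + 1)) * q) -
        C a * (legendre (n + 1) * q) - C b * (legendre n * q) := by
      have : r = d - C a * legendre (n + 1) - C b * legendre n := by rw [hs, hr]; ring
      rw [this, hd, weight_zero_zero, weight]; ring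
    rw [e5, map_sub, map_sub, map_add, map_sub, integral_C_mul, integral_C_mul, integral_C_mul,
      integral_C_mul, e1, e2, e3, e4]
    ring
  have hd1 : d.eval 1 = 0 := by simp [hd, legendre_eval_one]
  have hd2 : d.eval (-1) = 0 := by simp [hd, legendre_eval_neg_one, pow_succ]
  rw [hs, hr, hr0] at hd1 hd2
  simp only [eval_add, eval_mul, eval_C, legendre_eval_one, legendre_eval_neg_one, pow_succ,
    mul_one, add_zero] at hd1 hd2
  have hp : ((-1 : ℝ) ^ n) ≠ 0 := pow_ne_zero _ (by norm_num)
  have hab : b - a = 0 := by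
    refine (mul_eq_zero.1 (?_ : (b - a) * (-1 : ℝ) ^ n = 0)).resolve_right hp
    linear_combination hd2
  have ha : a = 0 := by linarith
  have hb : b = 0 := by linarith
  have hd0 : d = 0 := by rw [hs, hr, hr0, ha, hb]; simp
  exact (sub_eq_zero.1 hd0).symm

/-! ### Estimates in the weighted norm -/

theorem integral_one_add_X_mul_self_nonneg (u : ℝ[X]) : 0 ≤ integral ((1 + X) * (u * u)) := by
  rcases eq_or_ne u 0 with rfl | h0
  · simp
  · rw [← weight_zero_one]
    refine (integral_pos (mul_ne_zero (weight_ne_zero 0 1) (mul_ne_zero h0 h0))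
      fun x hx => ?_).le
    rw [eval_mul, eval_mul]
    exact mul_nonneg (weight_eval_nonneg 0 1 hx) (mul_self_nonneg _)

/-- Cauchy-Schwarz, from the discriminant of t ↦ ‖u + t g‖². -/
theorem integral_one_add_X_mul_sq_le (u g : ℝ[X]) :
    integral ((1 + X) * (u * g)) ^ 2 ≤
      integral ((1 + X) * (u * u)) * integral ((1 + X) * (g * g)) := by
  have h : ∀ t : ℝ, 0 ≤ integral ((1 + X) * (g * g)) * (t * t) +
      (2 * integral ((1 + X) * (u * g))) * t + integral ((1 + X) * (u * u)) := by
    intro t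
    have h1 := integral_one_add_X_mul_self_nonneg (u + C t * g)
    have h2 : (1 + X) * ((u + C t * g) * (u + C t * g)) = (1 + X) * (u * u) +
        C (2 * t) * ((1 + X) * (u * g)) + C (t * t) * ((1 + X) * (g * g)) := by
      rw [C_mul, C_mul, map_ofNat]; ring
    rw [h2, map_add, map_add, integral_C_mul, integral_C_mul] at h1
    linarith
  have h3 := discrim_le_zero h
  rw [discrim] at h3
  linarith

/-- The sum is the weighted inner product of u with P_n^{(0,1)}, whose squared norm is 2/(n + 1). -/
theorem integral_legendre_add_sq_le (n : ℕ) (u : ℝ[X]) :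
    (integral (legendre n * u) + integral (legendre (n + 1) * u)) ^ 2 ≤
      2 / (n + 1) * integral ((1 + X) * (u * u)) := by
  have h := integral_one_add_X_mul_sq_le u (jacobiOne n)
  rw [integral_jacobiOne_sq] at h
  rw [← map_add, ← add_mul, ← one_add_X_mul_jacobiOne, mul_assoc, mul_comm (jacobiOne n) u]
  linarith

theorem integral_legendre_sq_le {n : ℕ} {u : ℝ[X]} (hu : u.degree < (n + 1 : ℕ)) :
    integral (legendre n * u) ^ 2 ≤ 2 / (n + 1) * integral ((1 + X) * (u * u)) := by
  have h := integral_legendre_add_sq_le n u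
  rwa [integral_legendre_mul hu, add_zero] at h

/-- The optimal bound of the value at `-1` by the weighted norm. -/
theorem eval_neg_one_sq_le {n : ℕ} {u : ℝ[X]} (hu : u.degree < (n + 1 : ℕ)) :
    u.eval (-1) ^ 2 ≤ (n + 1) ^ 2 * (n + 2) ^ 2 / 8 * integral ((1 + X) * (u * u)) := by
  have hs := neg_one_pow_mul_self n
  set s : ℝ := (-1) ^ n with hs_def
  -- Here k reproduces u(-1) for the unweighted integral. The term a L_{n+1} is invisible to degree
  -- at most n, and a makes the sum vanish at -1; dividing by 1 + x gives the weighted reproducing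
  -- kernel g.
  set k : ℝ[X] := C (s * ((n + 1) / 2)) * jacobiOne n with hk
  set a : ℝ := s * ((n + 1) ^ 2 / 2) with ha
  have hroot : (k + C a * legendre (n + 1)).IsRoot (-1) := by
    rw [IsRoot, eval_add, hk, eval_mul, eval_mul, eval_C, eval_C, jacobiOne_eval_neg_one,
      legendre_eval_neg_one, ha, pow_succ, ← hs_def]
    ring
  obtain ⟨g, hg⟩ := dvd_iff_isRoot.2 hroot
  have hX : (X - C (-1) : ℝ[X]) = 1 + X := by rw [C_neg, C_1]; ring
  rw [hX] at hg
  have hrep : ∀ v : ℝ[X], v.degree < (n + 1 : ℕ) →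
      integral ((1 + X) * (v * g)) = v.eval (-1) := by
    intro v hv
    have h1 : (1 + X) * (v * g) = C (s * ((n + 1) / 2)) * (v * jacobiOne n) +
        C a * (legendre (n + 1) * v) := by
      rw [mul_left_comm, ← hg, hk]; ring
    rw [h1, map_add, integral_C_mul, integral_C_mul, integral_legendre_mul hv,
      integral_mul_jacobiOne hv, integral_jacobiOne, ← hs_def]
    have : (n : ℝ) + 1 ≠ 0 := by positivity
    field_simp
    linear_combination v.eval (-1) * hs
  have hgd : g.degree < (n + 1 : ℕ) := by
    rcases eq_or_ne g 0 with rfl | h0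
    · rw [degree_zero]; exact WithBot.bot_lt_coe _
    · have h1 : (k + C a * legendre (n + 1)).degree ≤ ((n + 1 : ℕ) : WithBot ℕ) := by
        refine (degree_add_le _ _).trans (max_le ?_ ?_)
        · exact (degree_C_mul_le_degree _ _).trans (degree_jacobiP_lt 0 1 n).le
        · exact (degree_C_mul_le_degree _ _).trans (degree_jacobiP 0 0 (n + 1)).le
      rw [hg, ← hX, degree_mul, degree_X_sub_C, degree_eq_natDegree h0] at h1
      rw [degree_eq_natDegree h0]
      norm_cast at h1 ⊢
      omega
  -- Differentiating (1 + x)g at -1 leaves g(-1), which by `hrep` is also the squared norm of g.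
  have hgv : g.eval (-1) = (n + 1) ^ 2 * (n + 2) ^ 2 / 8 := by
    have h := congrArg (fun p => (derivative p).eval (-1)) hg
    simp only [hk, derivative_mul, derivative_add, derivative_one, derivative_X, eval_add,
      eval_mul, eval_one, eval_X, eval_zero, derivative_legendre_eval_neg_one, derivative_C,
      eval_C, derivative_jacobiOne_eval_neg_one, ← hs_def, ha, pow_succ] at h
    push_cast at h
    linear_combination -h + ((n + 1) ^ 2 * (n + 2) ^ 2 / 8 : ℝ) * hs
  have h := integral_one_add_X_mul_sq_le u g
  rw [hrep u hu, hrep g hgd, hgv] at h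
  linarith

/-! ### The Legendre-Gauss-Lobatto rule -/

/-- The Legendre-Gauss-Lobatto quadrature functional. -/
noncomputable def quadrature (N : ℕ) : ℝ[X] →ₗ[ℝ] ℝ where
  toFun u := ∑ i, u.eval (lobattoNode 0 0 N i) * lobattoWeight 0 0 N i
  map_add' u v := by simp only [eval_add, add_mul, Finset.sum_add_distrib]
  map_smul' c u := by
    simp only [eval_smul, smul_eq_mul, mul_assoc, Finset.mul_sum, RingHom.id_apply]

theorem quadrature_apply (N : ℕ) (u : ℝ[X]) :
    quadrature N u = ∑ i, u.eval (lobattoNode 0 0 N i) * lobattoWeight 0 0 N i := rfl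

theorem quadrature_C_mul (N : ℕ) (c : ℝ) (u : ℝ[X]) :
    quadrature N (C c * u) = c * quadrature N u := by
  rw [← smul_eq_C_mul, map_smul, smul_eq_mul]

theorem quadrature_eq_integral {n : ℕ} {u : ℝ[X]} (hu : u.degree < (2 * n + 2 : ℕ)) :
    quadrature (n + 1) u = integral u := by
  have h : u.natDegree ≤ 2 * n + 1 := natDegree_le_of_degree_le (Order.le_of_lt_succ (by
    exact_mod_cast hu))
  rw [quadrature_apply, sum_lobattoWeight 0 0 n h, weight_zero_zero, mul_one]

theorem degree_mul_lt_of_lt {p q : ℝ[X]} {a b c : ℕ} (hp : p.degree < (a + 1 : ℕ))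
    (hq : q.degree < b) (h : a + b ≤ c) : (p * q).degree < c := by
  rcases eq_or_ne p 0 with rfl | hp0
  · rw [zero_mul, degree_zero]; exact WithBot.bot_lt_coe _
  rcases eq_or_ne q 0 with rfl | hq0
  · rw [mul_zero, degree_zero]; exact WithBot.bot_lt_coe _
  rw [degree_eq_natDegree hp0] at hp
  rw [degree_eq_natDegree hq0] at hq
  rw [degree_mul, degree_eq_natDegree hp0, degree_eq_natDegree hq0]
  norm_cast at hp hq ⊢
  omega

/-- The nodes annihilate (1 - x²)L_{n+1}', hence also x L_{n+1} - L_n. Under the rule, x L_{n+1} may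
thus be replaced by L_n, lowering the degree by two. -/
theorem lobattoNode_mul_legendre (n : ℕ) (i : Fin (n + 1 + 1)) :
    lobattoNode 0 0 (n + 1) i * (legendre (n + 1)).eval (lobattoNode 0 0 (n + 1) i) =
      (legendre n).eval (lobattoNode 0 0 (n + 1) i) := by
  have h1 := lobattoPoly_eval_node 0 0 n i
  have h2 := congrArg (eval (lobattoNode 0 0 (n + 1) i)) (X_sq_sub_one_mul_derivative_legendre n)
  rw [lobattoPoly, eval_mul] at h1
  simp only [eval_mul, eval_sub, eval_pow, eval_X, eval_one, eval_C] at h1 h2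
  have h3 : ((n : ℝ) + 1) ≠ 0 := by positivity
  refine sub_eq_zero.1 ((mul_eq_zero.1 (?_ : ((n : ℝ) + 1) * _ = 0)).resolve_left h3)
  linarith

theorem quadrature_X_mul_legendre (n : ℕ) (f : ℝ[X]) :
    quadrature (n + 1) (X * legendre (n + 1) * f) = quadrature (n + 1) (legendre n * f) := by
  simp only [quadrature_apply, eval_mul, eval_X, lobattoNode_mul_legendre]

theorem quadrature_legendre_mul_of_lt {n : ℕ} {r : ℝ[X]} (hr : r.degree < (n + 1 : ℕ)) :
    quadrature (n + 1) (legendre (n + 1) * r) = 0 := by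
  rw [quadrature_eq_integral (degree_mul_lt_of_lt (degree_jacobiP_lt 0 0 (n + 1)) hr (by omega)),
    integral_legendre_mul hr]

theorem quadrature_legendre_sq (n : ℕ) :
    quadrature (n + 1) (legendre (n + 1) * legendre (n + 1)) = 2 / (n + 1) := by
  set P := legendre (n + 1) with hP
  have hd : P.divX.degree < ((n + 1 : ℕ) : WithBot ℕ) := by
    have := degree_divX_lt (jacobiP_ne_zero 0 0 (n + 1))
    rwa [degree_jacobiP] at this
  -- The square has degree 2n + 2, one beyond exactness; splitting off a factor X from one copy
  -- allows the replacement of x L_{n+1} by L_n.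
  have h1 : P * P = X * P * P.divX + C (P.coeff 0) * (P * 1) := by
    have h := divX_mul_X_add P
    calc P * P = P * (P.divX * X + C (P.coeff 0)) := by rw [h]
      _ = _ := by ring
  have h2 : quadrature (n + 1) (P * 1) = 0 :=
    quadrature_legendre_mul_of_lt (by rw [degree_one]; exact_mod_cast Nat.succ_pos n)
  have h3 := jacobiLead_succ n
  have h4 := jacobiLead_pos 0 0 n
  rw [h1, map_add, quadrature_C_mul, h2, quadrature_X_mul_legendre, quadrature_eq_integral
    (degree_mul_lt_of_lt (degree_jacobiP_lt 0 0 n) hd (by omega)), integral_legendre_mul_eq hd,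
    coeff_divX, hP, coeff_jacobiP_self]
  field_simp
  linear_combination 2 * h3

theorem quadrature_legendre_mul {n : ℕ} {u : ℝ[X]} (hu : u.degree < (n + 1 + 1 : ℕ)) :
    quadrature (n + 1) (legendre (n + 1) * u) =
      u.coeff (n + 1) / jacobiLead 0 0 (n + 1) * (2 / (n + 1)) := by
  obtain ⟨r, hr, hr'⟩ := exists_eq_jacobiP_add 0 0 (n + 1) hu
  conv_lhs => rw [hr]
  rw [mul_add, map_add, quadrature_legendre_mul_of_lt hr', mul_left_comm, quadrature_C_mul,
    quadrature_legendre_sq, add_zero]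

theorem derivative_lobattoPoly (n : ℕ) : derivative (lobattoPoly 0 0 (n + 1)) =
    C (-((n + 1) * (n + 2)) : ℝ) * legendre (n + 1) := by
  have h := derivative_weight 0 0 (legendre (n + 1))
  rw [jacobiOp_jacobiP, weight_zero_zero, one_mul] at h
  have h1 : lobattoPoly 0 0 (n + 1) = weight (0 + 1) (0 + 1) * derivative (legendre (n + 1)) := by
    rw [lobattoPoly, weight]; ring
  rw [h1, h]
  congr 2
  push_cast; ring

theorem coeff_lobattoPoly (n : ℕ) :
    (lobattoPoly 0 0 (n + 1)).coeff (n + 2) = -((n + 1) * jacobiLead 0 0 (n + 1)) := by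
  have h := congrArg (fun p => p.coeff (n + 1)) (derivative_lobattoPoly n)
  simp only [coeff_derivative, coeff_C_mul, coeff_jacobiP_self] at h
  have h2 : ((n : ℝ) + 2) ≠ 0 := by positivity
  refine mul_right_cancel₀ h2 ?_
  push_cast at h
  rw [show (n : ℝ) + 2 = n + 1 + 1 by ring]
  linear_combination h

/-- Apply the rule to L_{n+1} w with w the nodal polynomial divided by X - ξ_i: only node i
contributes, and w(ξ_i) is the nodal derivative there, a multiple of L_{n+1}(ξ_i). -/
theorem lobattoWeight_mul_legendre_sq (n : ℕ) (i : Fin (n + 1 + 1)) :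
    lobattoWeight 0 0 (n + 1) i * (legendre (n + 1)).eval (lobattoNode 0 0 (n + 1) i) ^ 2 =
      2 / ((n + 1) * (n + 2)) := by
  obtain ⟨w, hw⟩ := dvd_iff_isRoot.2 (lobattoPoly_eval_node 0 0 n i)
  set ξ := lobattoNode 0 0 (n + 1) with hξ
  have hw0 : w ≠ 0 := by
    rintro rfl
    exact lobattoPoly_ne_zero 0 0 n (by rw [hw, mul_zero])
  have hwn : w.natDegree = n + 1 := by
    have h := natDegree_lobattoPoly 0 0 n
    rw [hw, natDegree_mul (X_sub_C_ne_zero _) hw0, natDegree_X_sub_C] at h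
    omega
  have hwd : w.degree < (n + 1 + 1 : ℕ) := by
    rw [degree_eq_natDegree hw0, hwn]; exact_mod_cast Nat.lt_succ_self _
  have hwc : w.coeff (n + 1) = -((n + 1) * jacobiLead 0 0 (n + 1)) := by
    rw [← coeff_lobattoPoly, hw, sub_mul, coeff_sub, coeff_X_mul, coeff_C_mul,
      coeff_eq_zero_of_natDegree_lt (p := w) (n := n + 2) (by omega), mul_zero, sub_zero]
  have hwi : w.eval (ξ i) = -((n + 1) * (n + 2)) * (legendre (n + 1)).eval (ξ i) := by
    have h := congrArg (fun p => (derivative p).eval (ξ i)) hw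
    rw [derivative_lobattoPoly] at h
    simpa using h.symm
  have hwj : ∀ j, j ≠ i → w.eval (ξ j) = 0 := by
    intro j hj
    have h := lobattoPoly_eval_node 0 0 n j
    rw [hw, eval_mul, eval_sub, eval_X, eval_C] at h
    exact (mul_eq_zero.1 h).resolve_left
      (sub_ne_zero.2 fun h' => hj (lobattoNode_injective 0 0 n h'))
  have hQ := quadrature_legendre_mul hwd
  rw [quadrature_apply, Finset.sum_eq_single i (fun j _ hj => by
    rw [eval_mul, ← hξ, hwj j hj, mul_zero, zero_mul]) (by simp), eval_mul, ← hξ, hwi, hwc] at hQ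
  have h4 := (jacobiLead_pos 0 0 (n + 1)).ne'
  field_simp at hQ ⊢
  linear_combination -hQ

theorem lobattoWeight_pos (n : ℕ) (i : Fin (n + 1 + 1)) : 0 < lobattoWeight 0 0 (n + 1) i := by
  have h := lobattoWeight_mul_legendre_sq n i
  have h2 : (0 : ℝ) < 2 / ((n + 1) * (n + 2)) := by positivity
  rw [← h] at h2
  exact pos_of_mul_pos_left h2 (sq_nonneg _)

/-- The sum is minus the logarithmic derivative at -1 of w, the nodal polynomial divided by 1 + x;
w(-1) and w'(-1) come from its first two derivatives, hence from L_{n+1} and L_{n+1}' at -1. -/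
theorem sum_one_div_one_add_lobattoNode (n : ℕ) :
    ∑ i : Fin (n + 1), 1 / (1 + lobattoNode 0 0 (n + 1) i.succ) = (n + 1) * (n + 2) / 4 := by
  have hr : (lobattoPoly 0 0 (n + 1)).IsRoot (-1) := by simp [IsRoot, lobattoPoly]
  obtain ⟨w, hw⟩ := dvd_iff_isRoot.2 hr
  have hω0 := lobattoPoly_ne_zero 0 0 n
  have hs : w.Splits := (splits_lobattoPoly 0 0 n).of_dvd hω0 ⟨X - C (-1), by rw [hw, mul_comm]⟩
  have h1 : derivative (lobattoPoly 0 0 (n + 1)) = w + (X - C (-1)) * derivative w := by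
    rw [hw]; simp
  have h2 : derivative (derivative (lobattoPoly 0 0 (n + 1))) =
      2 * derivative w + (X - C (-1)) * derivative (derivative w) := by
    rw [h1]; simp; ring
  have e1 := congrArg (eval (-1)) h1
  have e2 := congrArg (eval (-1)) h2
  rw [derivative_lobattoPoly] at e1 e2
  simp only [eval_mul, eval_C, eval_add, eval_sub, eval_X, derivative_C_mul, legendre_eval_neg_one,
    derivative_legendre_eval_neg_one, eval_ofNat] at e1 e2
  have hp : ((-1 : ℝ) ^ (n + 1)) ≠ 0 := pow_ne_zero _ (by norm_num)
  set s : ℝ := (-1) ^ (n + 1)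
  have hw1 : w.eval (-1) = -((n + 1) * (n + 2)) * s := by linear_combination -e1
  have hw2 : (derivative w).eval (-1) = (n + 1) ^ 2 * (n + 2) ^ 2 / 4 * s := by
    push_cast at e2
    linear_combination -e2 / 2
  have hk : ((n : ℝ) + 1) * (n + 2) ≠ 0 := by positivity
  have hd := hs.eval_derivative_eq_eval_mul_sum (x := -1)
    (by rw [hw1]; exact mul_ne_zero (neg_ne_zero.2 hk) hp)
  have hroots := roots_lobattoPoly_eq_map 0 0 n
  rw [hw, roots_mul (hw ▸ hω0), roots_X_sub_C] at hroots
  have hsum := congrArg (fun m => (m.map fun z : ℝ => 1 / (-1 - z)).sum) hroots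
  simp only [Multiset.map_add, Multiset.sum_add, Multiset.map_singleton, Multiset.sum_singleton,
    Multiset.map_map] at hsum
  change _ = ∑ i : Fin (n + 1 + 1), 1 / (-1 - lobattoNode 0 0 (n + 1) i) at hsum
  rw [Fin.sum_univ_succ, lobattoNode_zero, add_right_inj] at hsum
  rw [hsum, hw1, hw2] at hd
  have hneg : ∑ i : Fin (n + 1), 1 / (-1 - lobattoNode 0 0 (n + 1) i.succ) =
      -∑ i : Fin (n + 1), 1 / (1 + lobattoNode 0 0 (n + 1) i.succ) := by
    rw [← Finset.sum_neg_distrib]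
    refine Finset.sum_congr rfl fun i _ => ?_
    rw [← one_div_neg_eq_neg_one_div, neg_add']
  rw [hneg] at hd
  refine mul_left_cancel₀ (mul_ne_zero hk hp) ?_
  linear_combination -hd

/-- Test the rule with (1 - x) times the derivative of P_{n+1}^{(0,1)}, which vanishes at every node
except -1, and integrate by parts. -/
theorem lobattoWeight_zero_one_zero (n : ℕ) :
    lobattoWeight 0 1 (n + 1) 0 = 8 / ((n + 1) * (n + 2) ^ 2 * (n + 3)) := by
  set P := jacobiOne (n + 1) with hP
  have hdP : (derivative P).natDegree ≤ n :=
    (natDegree_derivative_le _).trans (by rw [hP, natDegree_jacobiP]; omega)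
  have hdeg : ((1 - X) * derivative P).natDegree ≤ 2 * n + 1 := by
    refine natDegree_mul_le.trans ?_
    have : (1 - X : ℝ[X]).natDegree ≤ 1 := by compute_degree
    omega
  have h := sum_lobattoWeight 0 1 n hdeg
  rw [Finset.sum_eq_single 0 (fun j _ hj => ?_) (by simp), lobattoNode_zero] at h
  · have h1 := integral_derivative ((1 - X ^ 2) * P)
    have h2 := integral_jacobiP_mul 0 1 (n + 1) (q := 1)
      (by rw [degree_one]; exact_mod_cast Nat.succ_pos n)
    have h3 := integral_jacobiOne (n + 1)
    rw [weight_zero_one, mul_one] at h2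
    change integral ((1 + X) * P) = 0 at h2
    have h4 : derivative ((1 - X ^ 2) * P) = (1 - X) * derivative P * (1 + X) +
        C 2 * P - C 2 * ((1 + X) * P) := by
      simp only [derivative_mul, derivative_sub, derivative_one, derivative_pow, derivative_X,
        map_ofNat, map_natCast]
      push_cast
      ring
    rw [h4, map_sub, map_add, integral_C_mul, integral_C_mul, h2, hP, h3] at h1
    rw [weight_zero_one, eval_mul, hP, derivative_jacobiOne_eval_neg_one] at h
    simp only [eval_mul, eval_sub, eval_one, eval_X, eval_pow] at h h1
    have hp : ((-1 : ℝ) ^ (n + 1)) ≠ 0 := pow_ne_zero _ (by norm_num)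
    set s : ℝ := (-1) ^ (n + 1)
    push_cast at h h1
    rw [eq_div_iff (by positivity)]
    refine mul_left_cancel₀ hp ?_
    have h5 : ((n : ℝ) + 1 + 1) * (2 * (s * (2 / (n + 1 + 1)))) = 4 * s := by
      field_simp; ring
    linear_combination (-2 * (n + 2) : ℝ) * (h + h1) + 2 * h5
  · have h1 := lobattoPoly_eval_node 0 1 n j
    have h2 : (1 : ℝ) + lobattoNode 0 1 (n + 1) j ≠ 0 := by
      linarith [neg_one_lt_lobattoNode 0 1 n hj] |> fun h : (0 : ℝ) < 1 + lobattoNode 0 1 (n + 1) j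
        => h.ne'
    have h3 : lobattoPoly 0 1 (n + 1) = (1 + X) * ((1 - X) * derivative P) := by
      rw [lobattoPoly]; ring
    rw [h3, eval_mul, eval_add, eval_one, eval_X] at h1
    rw [(mul_eq_zero.1 h1).resolve_left h2, zero_mul]

/-! ### Comparison of the discrete and the weighted norm -/

theorem weightedInner_eq_integral (u v : ℝ[X]) :
    weightedInner 0 1 u v = integral ((1 + X) * (u * v)) := by
  rw [weightedInner, integral_apply]
  congr 1
  ext x
  simp only [eval_mul, eval_add, eval_one, eval_X]
  ring

theorem lumpedWeight_zero (n : ℕ) :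
    lumpedWeight (n + 1) 0 = 8 / ((n + 1) * (n + 2) ^ 2 * (n + 3)) := by
  rw [lumpedWeight, if_pos rfl, lobattoWeight_zero_one_zero]

theorem lumpedWeight_succ (n : ℕ) (i : Fin (n + 1)) : lumpedWeight (n + 1) i.succ =
    (1 + lobattoNode 0 0 (n + 1) i.succ) * lobattoWeight 0 0 (n + 1) i.succ := by
  rw [lumpedWeight, if_neg (Fin.succ_ne_zero i)]

theorem one_add_lobattoNode_succ_pos (n : ℕ) (i : Fin (n + 1)) :
    0 < 1 + lobattoNode 0 0 (n + 1) i.succ := by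
  linarith [neg_one_lt_lobattoNode 0 0 n (Fin.succ_ne_zero i)]

theorem lumpedWeight_pos (n : ℕ) (i : Fin (n + 1 + 1)) : 0 < lumpedWeight (n + 1) i := by
  refine Fin.cases ?_ (fun i => ?_) i
  · rw [lumpedWeight_zero]; positivity
  · rw [lumpedWeight_succ]
    exact mul_pos (one_add_lobattoNode_succ_pos n i) (lobattoWeight_pos n _)

theorem discreteInner_eq_quadrature_add (n : ℕ) (u : ℝ[X]) : discreteInner (n + 1) u u =
    quadrature (n + 1) ((1 + X) * (u * u)) +
      8 / ((n + 1) * (n + 2) ^ 2 * (n + 3)) * u.eval (-1) ^ 2 := by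
  rw [discreteInner, quadrature_apply, Fin.sum_univ_succ, Fin.sum_univ_succ
    (fun i : Fin (n + 1 + 1) => eval (lobattoNode 0 0 (n + 1) i) ((1 + X) * (u * u)) *
      lobattoWeight 0 0 (n + 1) i), lumpedWeight_zero, lobattoNode_zero]
  simp only [lumpedWeight_succ, eval_mul, eval_add, eval_one, eval_X]
  have h : ∀ i : Fin (n + 1), eval (lobattoNode 0 0 (n + 1) i.succ) u *
      eval (lobattoNode 0 0 (n + 1) i.succ) u * ((1 + lobattoNode 0 0 (n + 1) i.succ) *
        lobattoWeight 0 0 (n + 1) i.succ) = (1 + lobattoNode 0 0 (n + 1) i.succ) *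
      (eval (lobattoNode 0 0 (n + 1) i.succ) u * eval (lobattoNode 0 0 (n + 1) i.succ) u) *
        lobattoWeight 0 0 (n + 1) i.succ := fun i => by ring
  rw [Finset.sum_congr rfl fun i _ => h i]
  ring

/-- Cauchy-Schwarz with the weights ρ̃_i leaves ∑ (ρ_i L_{n+1}(ξ_i))²/ρ̃_i. The interior and right
nodes contribute 1/2 and the node -1 contributes (n + 3)/(2(n + 1)), in total (n + 2)/(n + 1) ≤ 2.
-/
theorem quadrature_legendre_mul_sq_le (n : ℕ) (u : ℝ[X]) :
    quadrature (n + 1) (legendre (n + 1) * u) ^ 2 ≤ 2 * discreteInner (n + 1) u u := by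
  set ξ := lobattoNode 0 0 (n + 1) with hξ
  set ρ := lobattoWeight 0 0 (n + 1) with hρ
  set ω := lumpedWeight (n + 1) with hω
  have hcs := Finset.sum_sq_le_sum_mul_sum_of_sq_le_mul (Finset.univ : Finset (Fin (n + 1 + 1)))
    (r := fun i => (legendre (n + 1) * u).eval (ξ i) * ρ i)
    (f := fun i => (ρ i * (legendre (n + 1)).eval (ξ i)) ^ 2 / ω i)
    (g := fun i => u.eval (ξ i) * u.eval (ξ i) * ω i)
    (fun i _ => div_nonneg (sq_nonneg _) (lumpedWeight_pos n i).le)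
    (fun i _ => mul_nonneg (mul_self_nonneg _) (lumpedWeight_pos n i).le)
    (fun i _ => by
      have h : ω i ≠ 0 := (lumpedWeight_pos n i).ne'
      rw [eval_mul]
      refine le_of_eq ?_
      field_simp)
  refine hcs.trans (mul_le_mul_of_nonneg_right ?_
    (Finset.sum_nonneg fun i _ => mul_nonneg (mul_self_nonneg _) (lumpedWeight_pos n i).le))
  have hwt := lobattoWeight_mul_legendre_sq n
  have h0 : (ρ 0 * (legendre (n + 1)).eval (ξ 0)) ^ 2 / ω 0 = (n + 3) / (2 * (n + 1)) := by
    have h := hwt 0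
    rw [lobattoNode_zero, legendre_eval_neg_one, ← pow_mul, mul_comm (n + 1), pow_mul, neg_one_sq,
      one_pow, mul_one] at h
    rw [hξ, lobattoNode_zero, mul_pow, legendre_eval_neg_one, ← pow_mul, mul_comm (n + 1), pow_mul,
      neg_one_sq, one_pow, mul_one, hρ, h, hω, lumpedWeight_zero]
    field_simp
    ring
  have hs : ∀ i : Fin (n + 1), (ρ i.succ * (legendre (n + 1)).eval (ξ i.succ)) ^ 2 / ω i.succ =
      2 / ((n + 1) * (n + 2)) * (1 / (1 + ξ i.succ)) := by
    intro i
    have h1 := (lobattoWeight_pos n i.succ).ne'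
    have h2 := (one_add_lobattoNode_succ_pos n i).ne'
    rw [← hwt i.succ, hω, lumpedWeight_succ, ← hξ, ← hρ]
    rw [← hρ] at h1
    rw [← hξ] at h2
    field_simp
  rw [Fin.sum_univ_succ, h0, Finset.sum_congr rfl fun i _ => hs i, ← Finset.mul_sum,
    sum_one_div_one_add_lobattoNode]
  have h3 : ((n : ℝ) + 3) / (2 * (n + 1)) + 2 / ((n + 1) * (n + 2)) * ((n + 1) * (n + 2) / 4) =
      (n + 2) / (n + 1) := by
    field_simp; ring
  rw [h3, div_le_iff₀ (by positivity)]
  linarith [(Nat.cast_nonneg n : (0 : ℝ) ≤ n)]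

theorem discreteInner_X_mul_le (n : ℕ) (u : ℝ[X]) :
    discreteInner (n + 1) (X * u) (X * u) ≤ discreteInner (n + 1) u u := by
  refine Finset.sum_le_sum fun i _ => mul_le_mul_of_nonneg_right ?_ (lumpedWeight_pos n i).le
  have h := lobattoNode_mem_Icc 0 0 n i
  have h1 : lobattoNode 0 0 (n + 1) i ^ 2 ≤ 1 := by
    rw [sq_le_one_iff_abs_le_one]; exact abs_le.2 h
  simp only [eval_mul, eval_X]
  nlinarith [mul_le_mul_of_nonneg_right h1
    (sq_nonneg (u.eval (lobattoNode 0 0 (n + 1) i)))]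

/-- Both sides see only the component of u along L_{n+1}, whose exact and discrete squared norms are
2/(2n + 3) and 2/(n + 1). -/
theorem integral_legendre_eq_quadrature {n : ℕ} {u : ℝ[X]} (hu : u.degree < (n + 1 + 1 : ℕ)) :
    (2 * n + 3) * integral (legendre (n + 1) * u) =
      (n + 1) * quadrature (n + 1) (legendre (n + 1) * u) := by
  rw [quadrature_legendre_mul hu, integral_legendre_mul_eq hu]
  push_cast
  rw [show (2 * ((n : ℝ) + 1) + 1) = 2 * n + 3 by ring]
  field_simp

/-- The error of the Legendre-Gauss-Lobatto rule for `(1 + x) u²`. -/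
theorem quadrature_one_add_X_mul_sq {n : ℕ} {u : ℝ[X]} (hu : u.degree < (n + 1 + 1 : ℕ)) :
    quadrature (n + 1) ((1 + X) * (u * u)) = integral ((1 + X) * (u * u)) +
      (2 * n + 3) * (n + 2) / (2 * (n + 1)) * integral (legendre (n + 1) * u) ^ 2 +
      (n + 2) * (integral (legendre (n + 1) * u) * integral (legendre n * u)) := by
  obtain ⟨s, hs, hsd⟩ := exists_eq_jacobiP_add 0 0 (n + 1) hu
  obtain ⟨r, hr, hrd⟩ := exists_eq_jacobiP_add 0 0 n hsd
  set a := u.coeff (n + 1) / jacobiLead 0 0 (n + 1)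
  set b := s.coeff n / jacobiLead 0 0 n
  set P := legendre (n + 1) with hP
  set p := legendre n with hp
  have hPd := degree_jacobiP_lt 0 0 (n + 1)
  have hpd := degree_jacobiP_lt 0 0 n
  -- With u = aP + s and s = bp + r, the rule errs only on P² and X P p, giving the A² and AB terms:
  -- X P² has zero integral and zero quadrature, and the remaining terms are exact.
  have hexp : (1 + X) * (u * u) = C (a ^ 2) * (P * P) + C (a ^ 2) * (X * P * P) +
      C (2 * a) * (P * s) + C (2 * a * b) * (X * P * p) + C (2 * a) * (P * (X * r)) +
        (1 + X) * (s * s) := by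
    have h1 : u = C a * P + (C b * p + r) := by rw [← hr, ← hs]
    simp only [h1, hr, C_mul, C_pow, map_ofNat]
    ring
  have i1 : integral (P * P) = 2 / (2 * n + 3) := by
    rw [hP, integral_legendre_sq]; push_cast; ring
  have i2 : integral (X * P * P) = 0 := by rw [mul_assoc]; exact integral_X_mul_legendre_sq _
  have i3 : integral (P * s) = 0 := integral_legendre_mul hsd
  have i4 : integral (X * P * p) = (n + 1) / (2 * n + 1) * (2 / (2 * n + 3)) := by
    have h3 := jacobiLead_succ n
    have h4 := (jacobiLead_pos 0 0 n).ne'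
    have h5 := (jacobiLead_pos 0 0 (n + 1)).ne'
    rw [mul_comm X, mul_assoc, integral_legendre_mul_eq (degree_X_mul_lt hpd), coeff_X_mul,
      coeff_jacobiP_self]
    push_cast
    rw [show (2 * ((n : ℝ) + 1) + 1) = 2 * n + 3 by ring]
    congr 1
    rw [div_eq_div_iff h5 (by positivity)]
    linear_combination -h3
  have i5 : integral (P * (X * r)) = 0 := integral_legendre_mul (degree_X_mul_lt hrd)
  have q1 : quadrature (n + 1) (P * P) = 2 / (n + 1) := quadrature_legendre_sq n
  have q2 : quadrature (n + 1) (X * P * P) = 0 := by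
    rw [quadrature_X_mul_legendre, mul_comm]; exact quadrature_legendre_mul_of_lt hpd
  have q3 : quadrature (n + 1) (P * s) = 0 := quadrature_legendre_mul_of_lt hsd
  have q4 : quadrature (n + 1) (X * P * p) = 2 / (2 * n + 1) := by
    rw [quadrature_X_mul_legendre, quadrature_eq_integral
      (degree_mul_lt_of_lt hpd hpd (by omega)), integral_legendre_sq]
  have q5 : quadrature (n + 1) (P * (X * r)) = 0 :=
    quadrature_legendre_mul_of_lt (degree_X_mul_lt hrd)
  have q6 : quadrature (n + 1) ((1 + X) * (s * s)) = integral ((1 + X) * (s * s)) := by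
    refine quadrature_eq_integral ?_
    have h1 : ((1 + X : ℝ[X])).degree < ((1 + 1 : ℕ) : WithBot ℕ) := by
      refine (degree_add_le _ _).trans_lt (max_lt ?_ ?_)
      · rw [degree_one]; exact_mod_cast Nat.zero_lt_two
      · rw [degree_X]; exact_mod_cast Nat.one_lt_two
    exact degree_mul_lt_of_lt h1 (degree_mul_lt_of_lt (b := n + 1) (c := 2 * n + 1) hsd hsd
      (by omega)) (by omega)
  have hA : integral (P * u) = a * (2 / (2 * n + 3)) := by
    conv_lhs => rw [hs]
    rw [mul_add, map_add, mul_left_comm, integral_C_mul, i3, i1, add_zero]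
  have hB : integral (p * u) = b * (2 / (2 * n + 1)) := by
    conv_lhs => rw [hs, hr]
    rw [mul_add, mul_add, map_add, map_add, mul_left_comm, mul_left_comm p, integral_C_mul,
      integral_C_mul, mul_comm p, integral_legendre_mul hpd, integral_legendre_mul hrd,
      integral_legendre_sq]
    ring
  rw [hexp]
  simp only [map_add, integral_C_mul, quadrature_C_mul, i1, i2, i3, i4, i5, q1, q2, q3, q4, q5, q6,
    hA, hB]
  field_simp
  ring

theorem discreteInner_le {n : ℕ} {u : ℝ[X]} (hu : u.degree < (n + 1 + 1 : ℕ)) :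
    discreteInner (n + 1) u u ≤ 10 * weightedInner 0 1 u u := by
  rw [discreteInner_eq_quadrature_add, quadrature_one_add_X_mul_sq hu, weightedInner_eq_integral]
  have h1 := integral_legendre_sq_le hu
  have h2 := integral_legendre_add_sq_le n u
  have h3 := eval_neg_one_sq_le hu
  have hX := integral_one_add_X_mul_self_nonneg u
  set A := integral (legendre (n + 1) * u)
  set B := integral (legendre n * u)
  set N := integral ((1 + X) * (u * u))
  set v := u.eval (-1)
  have hn : (0 : ℝ) ≤ n := Nat.cast_nonneg n
  push_cast at h1 h3
  have e1 : (2 * n + 3) * (n + 2) / (2 * (n + 1)) * A ^ 2 ≤ 3 * N := by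
    refine (mul_le_mul_of_nonneg_left h1 (by positivity)).trans ?_
    rw [← mul_assoc]
    refine mul_le_mul_of_nonneg_right ?_ hX
    rw [div_mul_div_comm, div_le_iff₀ (by positivity)]
    nlinarith
  -- Polarization trades B for A + B, which has the direct bound `h2`. With `e1` and `e3` the
  -- constant is 1 + 3 + 3 + 3 = 10.
  have e2 : (n + 2) * (A * B) ≤ 3 * N := by
    have h4 : (n + 2) * (A * B) ≤ (n + 2) / 2 * (A ^ 2 + (B + A) ^ 2) := by
      have h5 : 0 ≤ ((n : ℝ) + 2) * (2 * A ^ 2 + B ^ 2) := by positivity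
      nlinarith
    refine h4.trans ((mul_le_mul_of_nonneg_left (add_le_add h1 h2) (by positivity)).trans ?_)
    rw [← add_mul, ← mul_assoc]
    refine mul_le_mul_of_nonneg_right ?_ hX
    have h6 : ((n : ℝ) + 2) / 2 * (2 / (n + 1 + 1) + 2 / (n + 1)) = 1 + (n + 2) / (n + 1) := by
      rw [show (n : ℝ) + 1 + 1 = n + 2 by ring]
      field_simp
    have h7 : ((n : ℝ) + 2) / (n + 1) ≤ 2 := by
      rw [div_le_iff₀ (by positivity)]; linarith
    linarith
  have e3 : 8 / ((n + 1) * (n + 2) ^ 2 * (n + 3)) * v ^ 2 ≤ 3 * N := by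
    refine (mul_le_mul_of_nonneg_left h3 (by positivity)).trans ?_
    rw [← mul_assoc]
    refine mul_le_mul_of_nonneg_right ?_ hX
    have h8 : 8 / (((n : ℝ) + 1) * (n + 2) ^ 2 * (n + 3)) *
        ((n + 1 + 1) ^ 2 * (n + 1 + 2) ^ 2 / 8) = (n + 3) / (n + 1) := by
      rw [show (n : ℝ) + 1 + 1 = n + 2 by ring, show (n : ℝ) + 1 + 2 = n + 3 by ring]
      field_simp
    rw [h8, div_le_iff₀ (by positivity)]
    linarith
  linarith

theorem weightedInner_le {n : ℕ} {u : ℝ[X]} (hu : u.degree < (n + 1 + 1 : ℕ)) :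
    weightedInner 0 1 u u ≤ 10 * (n + 1 : ℕ) * discreteInner (n + 1) u u := by
  have h1 := quadrature_legendre_mul_sq_le n u
  have h2 := (quadrature_legendre_mul_sq_le n (X * u)).trans
    (mul_le_mul_of_nonneg_left (discreteInner_X_mul_le n u) zero_le_two)
  -- At the nodes x L_{n+1} = L_n, and L_n u is within exactness; so B too is a quadrature against
  -- L_{n+1}, of x u.
  have h3 : quadrature (n + 1) (legendre (n + 1) * (X * u)) = integral (legendre n * u) := by
    rw [mul_left_comm, ← mul_assoc, quadrature_X_mul_legendre, quadrature_eq_integral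
      (degree_mul_lt_of_lt (degree_jacobiP_lt 0 0 n) hu (by omega))]
  have h4 := integral_legendre_eq_quadrature hu
  have h5 := quadrature_one_add_X_mul_sq hu
  have h6 := discreteInner_eq_quadrature_add n u
  rw [weightedInner_eq_integral]
  rw [h3] at h2
  set A := integral (legendre (n + 1) * u)
  set B := integral (legendre n * u)
  set A' := quadrature (n + 1) (legendre (n + 1) * u)
  set D := discreteInner (n + 1) u u
  set N := integral ((1 + X) * (u * u))
  set v := u.eval (-1)
  have hn : (0 : ℝ) ≤ n := Nat.cast_nonneg n
  have hD : 0 ≤ D := by nlinarith [sq_nonneg A']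
  have e1 : 0 ≤ (2 * n + 3) * (n + 2) / (2 * (n + 1)) * A ^ 2 := by positivity
  have e2 : 0 ≤ 8 / ((n + 1) * (n + 2) ^ 2 * (n + 3)) * v ^ 2 := by positivity
  -- The A² and u(-1)² terms are nonnegative and are dropped.
  have e3 : N ≤ D - (n + 2) * (A * B) := by linarith
  have e4 : -(A' * B) ≤ 2 * D := by nlinarith [sq_nonneg (A' + B)]
  have e5 : (2 * n + 3) * (-(A * B)) = (n + 1) * (-(A' * B)) := by linear_combination -B * h4
  have e6 : (2 * n + 3) * (-(A * B)) ≤ (n + 1) * (2 * D) := by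
    rw [e5]; exact mul_le_mul_of_nonneg_left e4 (by positivity)
  -- Uses (n + 2)/(2n + 3) ≤ 1; the remaining n + 1 is the loss of one power of N.
  have e7 : (n + 2) * (-(A * B)) ≤ 2 * (n + 1) * D := by
    have h7 : (2 * n + 3) * ((n + 2) * (-(A * B))) ≤ (2 * n + 3) * (2 * (n + 1) * D) := by
      have h8 := mul_le_mul_of_nonneg_left e6 (show (0 : ℝ) ≤ n + 2 by positivity)
      have h9 : 0 ≤ ((n : ℝ) + 1) * D * (n + 1) := by positivity
      nlinarith
    exact le_of_mul_le_mul_left h7 (by positivity)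
  push_cast
  nlinarith [mul_nonneg hn hD]

/-! ### Matrix form through nodal interpolation -/

/-- The polynomial with prescribed values at the Legendre-Gauss-Lobatto nodes. -/
noncomputable def nodalPoly (N : ℕ) (u : Fin (N + 1) → ℝ) : ℝ[X] :=
  ∑ i, C (u i) * lagrangeL N i

theorem nodalPoly_eq_interpolate (N : ℕ) (u : Fin (N + 1) → ℝ) :
    nodalPoly N u = Lagrange.interpolate Finset.univ (lobattoNode 0 0 N) u := by
  rw [Lagrange.interpolate_apply]; rfl

theorem nodalPoly_eval_node (n : ℕ) (u : Fin (n + 1 + 1) → ℝ) (i : Fin (n + 1 + 1)) :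
    (nodalPoly (n + 1) u).eval (lobattoNode 0 0 (n + 1) i) = u i := by
  rw [nodalPoly_eq_interpolate]
  exact Lagrange.eval_interpolate_at_node u (lobattoNode_injective 0 0 n).injOn (Finset.mem_univ i)

theorem degree_nodalPoly_lt (n : ℕ) (u : Fin (n + 1 + 1) → ℝ) :
    (nodalPoly (n + 1) u).degree < (n + 1 + 1 : ℕ) := by
  rw [nodalPoly_eq_interpolate]
  have h := Lagrange.degree_interpolate_lt (s := Finset.univ) u (lobattoNode_injective 0 0 n).injOn
  rwa [Finset.card_fin] at h

theorem lumpedMass_quadraticForm (n : ℕ) (u : Fin (n + 1 + 1) → ℝ) :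
    u ⬝ᵥ (lumpedMass (n + 1) *ᵥ u) =
      discreteInner (n + 1) (nodalPoly (n + 1) u) (nodalPoly (n + 1) u) := by
  simp only [dotProduct, lumpedMass, mulVec_diagonal, discreteInner, nodalPoly_eval_node]
  exact Finset.sum_congr rfl fun i _ => by ring

theorem massMatrix_apply (N : ℕ) (i j : Fin (N + 1)) :
    massMatrix N i j = integral ((1 + X) * (lagrangeL N i * lagrangeL N j)) := by
  rw [massMatrix, of_apply, integral_apply]
  congr 1
  ext x
  simp only [eval_mul, eval_add, eval_one, eval_X]
  ring

theorem massMatrix_quadraticForm (N : ℕ) (u : Fin (N + 1) → ℝ) :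
    u ⬝ᵥ (massMatrix N *ᵥ u) = weightedInner 0 1 (nodalPoly N u) (nodalPoly N u) := by
  rw [weightedInner_eq_integral, nodalPoly, Finset.sum_mul_sum, Finset.mul_sum, map_sum]
  simp only [dotProduct, mulVec, Finset.mul_sum, map_sum, massMatrix_apply]
  refine Finset.sum_congr rfl fun i _ => Finset.sum_congr rfl fun j _ => ?_
  rw [show (1 + X) * (C (u i) * lagrangeL N i * (C (u j) * lagrangeL N j)) =
    C (u i * u j) * ((1 + X) * (lagrangeL N i * lagrangeL N j)) by rw [C_mul]; ring,
    integral_C_mul]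
  ring

theorem lumpedMass_posDef (n : ℕ) : (lumpedMass (n + 1)).PosDef :=
  posDef_diagonal_iff.2 (lumpedWeight_pos n)

theorem massMatrix_isSymm (N : ℕ) : (massMatrix N).IsSymm := by
  ext i j
  rw [transpose_apply, massMatrix_apply, massMatrix_apply, mul_comm (lagrangeL N i)]

theorem lumpedMass_quadraticForm_le (n : ℕ) (u : Fin (n + 1 + 1) → ℝ) :
    u ⬝ᵥ (lumpedMass (n + 1) *ᵥ u) ≤ 10 * (u ⬝ᵥ (massMatrix (n + 1) *ᵥ u)) := by
  rw [lumpedMass_quadraticForm, massMatrix_quadraticForm]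
  exact discreteInner_le (degree_nodalPoly_lt n u)

theorem massMatrix_quadraticForm_le (n : ℕ) (u : Fin (n + 1 + 1) → ℝ) :
    u ⬝ᵥ (massMatrix (n + 1) *ᵥ u) ≤ 10 * (n + 1 : ℕ) * (u ⬝ᵥ (lumpedMass (n + 1) *ᵥ u)) := by
  rw [lumpedMass_quadraticForm, massMatrix_quadraticForm]
  exact weightedInner_le (degree_nodalPoly_lt n u)

theorem massMatrix_posDef (n : ℕ) : (massMatrix (n + 1)).PosDef := by
  refine posDef_iff_dotProduct_mulVec.2 ⟨?_, fun {u} hu => ?_⟩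
  · rw [IsHermitian, conjTranspose_eq_transpose_of_trivial]
    exact massMatrix_isSymm (n + 1)
  · have h1 := (lumpedMass_posDef n).dotProduct_mulVec_pos hu
    rw [star_trivial] at h1 ⊢
    linarith [lumpedMass_quadraticForm_le n u]

/-! ### Eigenvalues of D⁻¹M -/

section Pencil

variable {m : ℕ} {D M : Matrix (Fin m) (Fin m) ℝ}

/-- The eigenvalues of `D⁻¹ M` are real and bounded by the extreme values of the generalized
Rayleigh quotient. -/
theorem eigenvalueModuli_inv_mul_bounds (hD : D.PosDef) (hM : M.IsSymm) {a b : ℝ} (ha : 0 ≤ a)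
    (h1 : ∀ u, a * (u ⬝ᵥ (D *ᵥ u)) ≤ u ⬝ᵥ (M *ᵥ u))
    (h2 : ∀ u, u ⬝ᵥ (M *ᵥ u) ≤ b * (u ⬝ᵥ (D *ᵥ u))) {r : ℝ}
    (hr : r ∈ eigenvalueModuli (D⁻¹ * M)) : a ≤ r ∧ r ≤ b := by
  obtain ⟨z, hz, rfl⟩ := hr
  rw [← Matrix.spectrum_toLin', ← Module.End.hasEigenvalue_iff_mem_spectrum] at hz
  obtain ⟨v, hv⟩ := hz.exists_hasEigenvector
  -- A complex eigenvector v = x + iy gives two coupled real equations in x and y.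
  have hv1 := hv.apply_eq_smul
  rw [toLin'_apply] at hv1
  set x : Fin m → ℝ := fun i => (v i).re with hx
  set y : Fin m → ℝ := fun i => (v i).im with hy
  have hAx : (D⁻¹ * M) *ᵥ x = z.re • x - z.im • y := by
    ext i
    have h := congrArg Complex.re (congrFun hv1 i)
    simpa [mulVec, dotProduct] using h
  have hAy : (D⁻¹ * M) *ᵥ y = z.re • y + z.im • x := by
    ext i
    have h := congrArg Complex.im (congrFun hv1 i)
    simpa [mulVec, dotProduct] using h
  have hDM : D * (D⁻¹ * M) = M :=
    mul_nonsing_inv_cancel_left _ _ ((isUnit_iff_isUnit_det D).1 hD.isUnit)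
  have hMx : M *ᵥ x = z.re • (D *ᵥ x) - z.im • (D *ᵥ y) := by
    rw [← hDM, ← mulVec_mulVec, hAx, mulVec_sub, mulVec_smul, mulVec_smul]
  have hMy : M *ᵥ y = z.re • (D *ᵥ y) + z.im • (D *ᵥ x) := by
    rw [← hDM, ← mulVec_mulVec, hAy, mulVec_add, mulVec_smul, mulVec_smul]
  have hsymm : ∀ {A : Matrix (Fin m) (Fin m) ℝ}, Aᵀ = A → x ⬝ᵥ (A *ᵥ y) = y ⬝ᵥ (A *ᵥ x) := by
    intro A hA
    rw [dotProduct_mulVec, ← mulVec_transpose, hA, dotProduct_comm]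
  have hDs := hsymm (A := D) (by
    rw [← conjTranspose_eq_transpose_of_trivial]; exact hD.isHermitian)
  have hMs := hsymm (A := M) hM
  have e1 : x ⬝ᵥ (M *ᵥ x) = z.re * (x ⬝ᵥ (D *ᵥ x)) - z.im * (x ⬝ᵥ (D *ᵥ y)) := by
    rw [hMx, dotProduct_sub, dotProduct_smul, dotProduct_smul, smul_eq_mul, smul_eq_mul]
  have e2 : y ⬝ᵥ (M *ᵥ y) = z.re * (y ⬝ᵥ (D *ᵥ y)) + z.im * (y ⬝ᵥ (D *ᵥ x)) := by
    rw [hMy, dotProduct_add, dotProduct_smul, dotProduct_smul, smul_eq_mul, smul_eq_mul]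
  have e3 : x ⬝ᵥ (M *ᵥ y) = z.re * (x ⬝ᵥ (D *ᵥ y)) + z.im * (x ⬝ᵥ (D *ᵥ x)) := by
    rw [hMy, dotProduct_add, dotProduct_smul, dotProduct_smul, smul_eq_mul, smul_eq_mul]
  have e4 : y ⬝ᵥ (M *ᵥ x) = z.re * (y ⬝ᵥ (D *ᵥ x)) - z.im * (y ⬝ᵥ (D *ᵥ y)) := by
    rw [hMx, dotProduct_sub, dotProduct_smul, dotProduct_smul, smul_eq_mul, smul_eq_mul]
  have hnn : ∀ u : Fin m → ℝ, 0 ≤ u ⬝ᵥ (D *ᵥ u) := fun u => by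
    simpa using hD.posSemidef.dotProduct_mulVec_nonneg u
  have hpos : 0 < x ⬝ᵥ (D *ᵥ x) + y ⬝ᵥ (D *ᵥ y) := by
    by_cases hx0 : x = 0
    · have hy0 : y ≠ 0 := by
        intro hy0
        refine hv.2 (funext fun i => Complex.ext ?_ ?_)
        · exact congrFun hx0 i
        · exact congrFun hy0 i
      have h := hD.dotProduct_mulVec_pos hy0
      rw [star_trivial] at h
      linarith [hnn x]
    · have h := hD.dotProduct_mulVec_pos hx0
      rw [star_trivial] at h
      linarith [hnn y]
  set S := x ⬝ᵥ (D *ᵥ x) + y ⬝ᵥ (D *ᵥ y) with hS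
  -- Symmetry of D and M cancels the mixed terms of xᵀMy - yᵀMx, leaving Im z times a positive
  -- number.
  have him : z.im = 0 := by
    refine (mul_eq_zero.1 (?_ : z.im * S = 0)).resolve_right hpos.ne'
    rw [hS]
    linear_combination hMs - z.re * hDs - e3 + e4
  have hre : z.re * S = x ⬝ᵥ (M *ᵥ x) + y ⬝ᵥ (M *ᵥ y) := by
    rw [hS]
    linear_combination -e1 - e2 + z.im * hDs
  have hlo : a ≤ z.re := by
    refine le_of_mul_le_mul_right ?_ hpos
    rw [hre, hS, mul_add]
    exact add_le_add (h1 x) (h1 y)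
  have hhi : z.re ≤ b := by
    refine le_of_mul_le_mul_right ?_ hpos
    rw [hre, hS, mul_add]
    exact add_le_add (h2 x) (h2 y)
  have hz' : z = (z.re : ℂ) := Complex.ext (by simp) (by simp [him])
  have hnorm : ‖z‖ = z.re := by
    rw [hz', Complex.norm_real, Complex.ofReal_re, Real.norm_of_nonneg (ha.trans hlo)]
  exact ⟨hlo.trans_eq hnorm.symm, hnorm.trans_le hhi⟩

theorem eigenvalueModuli_nonempty (A : Matrix (Fin (m + 1)) (Fin (m + 1)) ℝ) :
    (eigenvalueModuli A).Nonempty :=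
  (spectrum.nonempty_of_isAlgClosed_of_finiteDimensional ℂ _).image _

theorem condNumber_inv_mul_le {D M : Matrix (Fin (m + 1)) (Fin (m + 1)) ℝ} (hD : D.PosDef)
    (hM : M.IsSymm) {a b : ℝ} (ha : 0 < a)
    (h1 : ∀ u, a * (u ⬝ᵥ (D *ᵥ u)) ≤ u ⬝ᵥ (M *ᵥ u))
    (h2 : ∀ u, u ⬝ᵥ (M *ᵥ u) ≤ b * (u ⬝ᵥ (D *ᵥ u))) :
    condNumber (D⁻¹ * M) ≤ b / a := by
  have hne := eigenvalueModuli_nonempty (D⁻¹ * M)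
  have hb := fun r hr => eigenvalueModuli_inv_mul_bounds hD hM ha.le h1 h2 (r := r) hr
  obtain ⟨r, hr⟩ := id hne
  exact div_le_div₀ (ha.le.trans ((hb r hr).1.trans (hb r hr).2))
    (csSup_le hne fun r hr => (hb r hr).2) ha (le_csInf hne fun r hr => (hb r hr).1)

end Pencil

end JacobiMass

theorem mainTheorem11 :
    ∃ C : ℝ, 0 < C ∧ ∀ N : ℕ, 1 ≤ N →
      -- equivalence of the discrete norm and the weighted norm on polynomials of degree `≤ N`
      (∀ u : ℝ[X], u.natDegree ≤ N →
        JacobiMass.discreteInner N u u ≤ C * JacobiMass.weightedInner 0 1 u u ∧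
        JacobiMass.weightedInner 0 1 u u ≤ C * N * JacobiMass.discreteInner N u u) ∧
      -- the same in matrix form
      (∀ u : Fin (N + 1) → ℝ,
        u ⬝ᵥ (JacobiMass.lumpedMass N *ᵥ u) ≤ C * (u ⬝ᵥ (JacobiMass.massMatrix N *ᵥ u)) ∧
        u ⬝ᵥ (JacobiMass.massMatrix N *ᵥ u) ≤ C * N * (u ⬝ᵥ (JacobiMass.lumpedMass N *ᵥ u))) ∧
      -- both matrices are positive definite, and the preconditioned matrix has condition
      -- number `O(N)`
      (JacobiMass.lumpedMass N).PosDef ∧ (JacobiMass.massMatrix N).PosDef ∧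
      JacobiMass.condNumber ((JacobiMass.lumpedMass N)⁻¹ * JacobiMass.massMatrix N) ≤ C * N := by
  -- The quadratic forms satisfy D ≤ 10 M and M ≤ 10 N D; the condition number is then at most 10
  -- N/(1/10) = 100 N, and 100 also covers the other bounds.
  refine ⟨100, by norm_num, fun N hN => ?_⟩
  obtain ⟨n, rfl⟩ := Nat.exists_eq_succ_of_ne_zero (Nat.one_le_iff_ne_zero.1 hN)
  have aux : ∀ {d x : ℝ}, 0 ≤ d → 0 ≤ x → d ≤ 10 * x → x ≤ 10 * (n + 1 : ℕ) * d →
      d ≤ 100 * x ∧ x ≤ 100 * (n + 1 : ℕ) * d := by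
    intro d x hd hx h1 h2
    have h3 : 0 ≤ ((n + 1 : ℕ) : ℝ) * d := by positivity
    exact ⟨by linarith, by linarith⟩
  refine ⟨fun u hu => ?_, fun u => ?_, JacobiMass.lumpedMass_posDef n,
    JacobiMass.massMatrix_posDef n, ?_⟩
  · have hd : u.degree < ((n + 1 + 1 : ℕ) : WithBot ℕ) :=
      (degree_le_of_natDegree_le hu).trans_lt (by exact_mod_cast Nat.lt_succ_self (n + 1))
    refine aux ?_ ?_ (JacobiMass.discreteInner_le hd) (JacobiMass.weightedInner_le hd)
    · exact Finset.sum_nonneg fun i _ =>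
        mul_nonneg (mul_self_nonneg _) (JacobiMass.lumpedWeight_pos n i).le
    · rw [JacobiMass.weightedInner_eq_integral]
      exact JacobiMass.integral_one_add_X_mul_self_nonneg u
  · refine aux ?_ ?_ (JacobiMass.lumpedMass_quadraticForm_le n u)
      (JacobiMass.massMatrix_quadraticForm_le n u)
    · simpa using (JacobiMass.lumpedMass_posDef n).posSemidef.dotProduct_mulVec_nonneg u
    · simpa using (JacobiMass.massMatrix_posDef n).posSemidef.dotProduct_mulVec_nonneg u
  · refine (JacobiMass.condNumber_inv_mul_le (JacobiMass.lumpedMass_posDef n)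
      (JacobiMass.massMatrix_isSymm (n + 1)) (a := 1 / 10) (by norm_num) (fun u => ?_)
      (JacobiMass.massMatrix_quadraticForm_le n)).trans (le_of_eq (by push_cast; ring))
    linarith [JacobiMass.lumpedMass_quadraticForm_le n u]
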